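/- **Games and losses.** A component maintenance game with $n$ agents is given by repair costs $C_1,\dots,C_n\in\mathbb{R}$, a common prior $\theta$ on $\{0,1\}^n$ under which the component states $x_1,\dots,x_n$ are independent, and an arbitrary Boolean system function $\phi:\{0,1\}^n\to\{0,1\}$. Under the joint action $s\in\{0,1\}^n$ ($s_i=1$: agent $i$ repairs) agent $i$ pays $\mathrm{cost}_i(s)=C_is_i+1-\mathbb{E}_{x\sim\theta}[\phi(x')]$ with $x'_j=\max\{x_j,s_j\}$. A non-uniform subsidy vector $\sigma\in[0,H]^n$ pays $\mathrm{subs}_i(s)=\sigma_is_i$ to agent $i$, so agent $i$ pays $\mathrm{cost}_i^\sigma=\mathrm{cost}_i-\mathrm{subs}_i$. With $\mathcal{S}_{NE}(\sigma)$ the (always nonempty) set of pure Nash equilibria of the subsidized game, the loss is $$L(\sigma)=\max_{s\in\mathcal{S}_{NE}(\sigma)}\ \sum_{i=1}^n\big(\mathrm{cost}_i^{\sigma}(s)+\mathrm{subs}_i(s)\big).$$ **Assumptions.** Let $H,\kappa>0$. Consider $T$ such games with $n$ agents and losses $L_1,\dots,L_T$. The priors and system functions of the rounds are chosen by an adversary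 in advance. The costs are random and independent between rounds. In each round the law of each cost $C_{t,i}$ has a density bounded by $\kappa$; costs of different agents in the same round may be dependent. Almost surely $C_{t,i}\le H$ for all $t,i$, and $L_t\ge 0$ on $[0,H]^n$ (automatic if $C_{t,i}\ge 0$), so that $L_t:[0,H]^n\to[0,(2H+1)n]$. **Theorem.** 1. *(The sequence is $\tfrac12$-dispersed, with every Lipschitz constant $\ell\ge 0$.)* There are $K,p$ depending only on $n,H,\kappa$ such that for all $T$, all such sequences, all $\ell\ge0$ and all $\epsilon\ge T^{-1/2}$, $$\mathbb{E}\Big[\max_{\rho,\rho'\in[0,H]^n,\ \|\rho-\rho'\|_2\le\epsilon}\big|\{t\le T:\ |L_t(\rho)-L_t(\rho')|>\ell\|\rho-\rho'\|_2\}\big|\Big]\le K\,\epsilon T\,(1+\log T)^p .$$ 2. *($\tilde O(\sqrt{nT})$ expected regret, relative to the range $(2H+1)n$ of the losses.)* There is an absolute constant $A$ such that for all $n,H,\kappa,T$ there is a randomized online algorithm, which draws $\sigma_t\in[0,H]^n$ knowing only the functions $L_1,\dots,L_{t-1}$ on $[0,H]^n$, whose regret $R_T=\sum_{t=1}^TL_t(\sigma_t)-\min_{\sigma\in[0,H]^n}\sum_{t=1}^TL_t(\sigma)$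 satisfies, for every such sequence, $$\mathbb{E}[R_T]\le A\,(2H+1)n\,\sqrt{nT\,\log\!\big(2+T+\kappa H n2^{n}\big)};$$ in particular, for the same algorithm, $\mathbb{E}[R_T]\le A\,(2H+1)n\,\sqrt{nT\log T}$ whenever $T\ge 2+\kappa Hn2^{n}$. -/

import Mathlib

open MeasureTheory ProbabilityTheory

noncomputable section

/-- A component maintenance game with `n` agents. Agent `i` owns component `i`, whose repair
costs `repairCost i`; under the common prior, the components function independently of each
other, component `i` with probability `workProb i`; `system` is the binary function that gives
the state of the system from the states of the components. -/
@[ext]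
structure ComponentGame (n : ℕ) where
  repairCost : Fin n → ℝ
  workProb : Fin n → unitInterval
  system : (Fin n → Bool) → Bool

namespace ComponentGame

variable {n : ℕ}

/-- The data of a game as a tuple; it only serves to measure sets of games. -/
def toTuple (G : ComponentGame n) :
    (Fin n → ℝ) × (Fin n → unitInterval) × ((Fin n → Bool) → Bool) :=
  (G.repairCost, G.workProb, G.system)

instance : MeasurableSpace (ComponentGame n) := MeasurableSpace.comap toTuple inferInstance

/-- The prior probability of the vector `x` of component states. -/
def prior (G : ComponentGame n) (x : Fin n → Bool) : ℝ :=
  ∏ i, if x i then (G.workProb i : ℝ) else 1 - (G.workProb i : ℝ)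

/-- The probability that the system works when the agents act by `s` (`s i = true`: agent `i`
repairs; `s i = false`: agent `i` does nothing): the expectation of `φ (x')` under the prior,
where `x' i = max (x i) (s i)`. -/
def workingProb (G : ComponentGame n) (s : Fin n → Bool) : ℝ :=
  ∑ x : Fin n → Bool, G.prior x * (if G.system (fun i => x i || s i) then 1 else 0)

/-- The (expected) cost `C_i s_i + 1 - 𝔼[φ(x')]` of agent `i` under the joint action `s`. -/
def cost (G : ComponentGame n) (s : Fin n → Bool) (i : Fin n) : ℝ :=
  (if s i then G.repairCost i else 0) + 1 - G.workingProb s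

end ComponentGame

/-- The subsidy paid to agent `i` under the joint action `s` by the non-uniform scheme with
subsidy vector `σ`: agent `i` receives `σ i` if it repairs and nothing otherwise. -/
def subs {n : ℕ} (σ : EuclideanSpace ℝ (Fin n)) (s : Fin n → Bool) (i : Fin n) : ℝ :=
  if s i then σ i else 0

namespace ComponentGame

variable {n : ℕ}

/-- The cost of agent `i` in the subsidized game. -/
def subsidizedCost (G : ComponentGame n) (σ : EuclideanSpace ℝ (Fin n)) (s : Fin n → Bool)
    (i : Fin n) : ℝ :=
  G.cost s i - subs σ s i

/-- `s` is a pure Nash equilibrium of the game subsidized by `σ`. -/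
def IsNash (G : ComponentGame n) (σ : EuclideanSpace ℝ (Fin n)) (s : Fin n → Bool) : Prop :=
  ∀ (i : Fin n) (a : Bool),
    G.subsidizedCost σ s i ≤ G.subsidizedCost σ (Function.update s i a) i

open Classical in
/-- The set of pure Nash equilibria of the game subsidized by `σ`. -/
def nashSet (G : ComponentGame n) (σ : EuclideanSpace ℝ (Fin n)) : Finset (Fin n → Bool) :=
  Finset.univ.filter fun s => G.IsNash σ s

/-- The subsidized game has an exact potential, so pure Nash equilibria exist. -/
theorem nashSet_nonempty (G : ComponentGame n) (σ : EuclideanSpace ℝ (Fin n)) :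
    (G.nashSet σ).Nonempty := by
  classical
  obtain ⟨s, hs⟩ := Finite.exists_min (fun s : Fin n → Bool =>
    (∑ j, if s j then G.repairCost j - σ j else 0) - G.workingProb s)
  refine ⟨s, ?_⟩
  simp only [nashSet, Finset.mem_filter, Finset.mem_univ, true_and]
  intro i a
  have h := hs (Function.update s i a)
  simp only at h
  rw [← Finset.add_sum_erase _ _ (Finset.mem_univ i),
    ← Finset.add_sum_erase (f := fun j => if (Function.update s i a) j then _ else _) _
      (Finset.mem_univ i)] at h
  have e : ∑ j ∈ Finset.univ.erase i,
        (if (Function.update s i a) j then G.repairCost j - σ j else 0)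
      = ∑ j ∈ Finset.univ.erase i, (if s j then G.repairCost j - σ j else 0) := by
    refine Finset.sum_congr rfl fun j hj => ?_
    rw [Function.update_of_ne (Finset.ne_of_mem_erase hj)]
  rw [e] at h
  simp only [subsidizedCost, cost, subs, Function.update_self] at h ⊢
  split_ifs at h ⊢ <;> linarith

/-- The loss of the central agent: the largest value, over the Nash equilibria `s` of the
subsidized game, of the social cost of the subsidized game plus the total subsidy paid. -/
def loss (G : ComponentGame n) (σ : EuclideanSpace ℝ (Fin n)) : ℝ :=
  (G.nashSet σ).sup' (G.nashSet_nonempty σ) fun s =>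
    ∑ i, G.subsidizedCost σ s i + ∑ i, subs σ s i

end ComponentGame

/-- The cube `[0, H]^n` of subsidy vectors, with the Euclidean distance. -/
def subsidyCube (n : ℕ) (H : ℝ) : Set (EuclideanSpace ℝ (Fin n)) :=
  {σ | ∀ i, σ i ∈ Set.Icc 0 H}

/-- The largest number of the functions `L 0, …, L (T - 1)` that violate the `ℓ`-Lipschitz
condition at one pair of points of `D` at distance at most `ε`. -/
def nonLipschitzCount {E : Type*} [PseudoMetricSpace E] {T : ℕ} (D : Set E) (L : Fin T → E → ℝ)
    (ℓ ε : ℝ) : ℕ :=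
  sSup {k : ℕ | ∃ ρ ∈ D, ∃ ρ' ∈ D, dist ρ ρ' ≤ ε ∧
    k = Nat.card {t : Fin T // ℓ * dist ρ ρ' < |L t ρ - L t ρ'|}}

/-- `β`-dispersion for the Lipschitz constant `ℓ` of a sequence of `T` random functions on `D`:
for all `ε ≥ T ^ (-β)`, the expectation of `nonLipschitzCount` is at most `ε T`, up to the
constant `K` and the logarithmic factor `(1 + log T) ^ p`. -/
def IsDispersed {E Ω : Type*} [PseudoMetricSpace E] [MeasurableSpace Ω] (P : Measure Ω) {T : ℕ}
    (D : Set E) (L : Fin T → Ω → E → ℝ) (β ℓ K : ℝ) (p : ℕ) : Prop :=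
  ∀ ε : ℝ, (T : ℝ) ^ (-β) ≤ ε →
    Integrable (fun ω => (nonLipschitzCount D (fun t => L t ω) ℓ ε : ℝ)) P ∧
    ∫ ω, (nonLipschitzCount D (fun t => L t ω) ℓ ε : ℝ) ∂P
      ≤ K * (ε * T) * (1 + Real.log T) ^ p

/-- A random sequence of `T` component maintenance games with `n` agents. The priors and the
system functions of the rounds are arbitrary (`workProb`, `system`), the repair costs are random.
The rounds are independent; in each round, the law of each cost has a density bounded by `κ`
(the costs of different agents in one round may depend on each other); costs are at most `H`;
and the losses on `[0, H]^n` are nonnegative. -/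
structure IsSmoothGameSequence {n T : ℕ} {Ω : Type*} [MeasurableSpace Ω] (P : Measure Ω)
    (H κ : ℝ) (G : Fin T → Ω → ComponentGame n) (workProb : Fin T → Fin n → unitInterval)
    (system : Fin T → (Fin n → Bool) → Bool) : Prop where
  workProb_eq : ∀ t ω, (G t ω).workProb = workProb t
  system_eq : ∀ t ω, (G t ω).system = system t
  measurable_cost : ∀ t, Measurable fun ω => (G t ω).repairCost
  indep : iIndepFun (fun t ω => (G t ω).repairCost) P
  bounded_density : ∀ t i, ∃ f : ℝ → ENNReal, Measurable f ∧ (∀ x, f x ≤ ENNReal.ofReal κ) ∧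
    P.map (fun ω => (G t ω).repairCost i) = volume.withDensity f
  cost_le : ∀ᵐ ω ∂P, ∀ t i, (G t ω).repairCost i ≤ H
  loss_nonneg : ∀ᵐ ω ∂P, ∀ t, ∀ σ ∈ subsidyCube n H, 0 ≤ (G t ω).loss σ

/-- A randomized online algorithm: in the round with index `t`, the subsidy vector is drawn from
the distribution that `policy t` assigns to the sequence of the `t` games played before. The
algorithm uses these games only through their loss functions on `[0, H]^n`. -/
structure OnlineAlgorithm (n : ℕ) (H : ℝ) where
  policy : ∀ t : ℕ, Kernel (Fin t → ComponentGame n) (subsidyCube n H)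
  markov : ∀ t, IsMarkovKernel (policy t)
  uses_losses : ∀ (t : ℕ) (h h' : Fin t → ComponentGame n),
    (∀ s, ∀ σ ∈ subsidyCube n H, (h s).loss σ = (h' s).loss σ) → policy t h = policy t h'

/-- The regret of the algorithm on a sequence `g` of `T` games, in expectation over the internal
randomness of the algorithm: its cumulative loss minus the cumulative loss of the best fixed
subsidy vector in hindsight. -/
def OnlineAlgorithm.regret {n : ℕ} {H : ℝ} (alg : OnlineAlgorithm n H) {T : ℕ}
    (g : Fin T → ComponentGame n) : ℝ :=
  ∑ t : Fin T, ∫ σ, (g t).loss σ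
      ∂(alg.policy t fun s : Fin (t : ℕ) => g (Fin.castLE t.isLt.le s))
    - ⨅ σ : subsidyCube n H, ∑ t : Fin T, (g t).loss σ

end

/-! ### Expected maximal number of occurrences -/

/-- The largest number, over `j`, of the indices `t` with `y t ∈ S t j`. -/
noncomputable def maxHits {τ J β : Type*} [Fintype τ] [Fintype J] (S : τ → J → Set β) (y : τ → β) : ℕ :=
  Finset.univ.sup fun j => Nat.card {t // y t ∈ S t j}

section MaxHits

variable {τ J β Ω : Type*} [Fintype τ] [Fintype J]

lemma card_le_maxHits (S : τ → J → Set β) (y : τ → β) (j : J) :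
    Nat.card {t // y t ∈ S t j} ≤ maxHits S y :=
  Finset.le_sup (f := fun j => Nat.card {t // y t ∈ S t j}) (Finset.mem_univ j)

lemma maxHits_le_card (S : τ → J → Set β) (y : τ → β) : maxHits S y ≤ Fintype.card τ := by
  refine Finset.sup_le fun j _ => ?_
  rw [← Nat.card_eq_fintype_card]
  exact Finite.card_subtype_le _

lemma exists_maxHits_eq [Nonempty J] (S : τ → J → Set β) (y : τ → β) :
    ∃ j, maxHits S y = Nat.card {t // y t ∈ S t j} := by
  obtain ⟨j, -, hj⟩ := Finset.exists_mem_eq_sup Finset.univ Finset.univ_nonempty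
    (fun j => Nat.card {t // y t ∈ S t j})
  exact ⟨j, hj⟩

lemma natCard_eq_sum_indicator (s : τ → Set β) (y : τ → β) :
    (Nat.card {t // y t ∈ s t} : ℝ) = ∑ t, (s t).indicator (fun _ => (1 : ℝ)) (y t) := by
  classical
  rw [Nat.card_eq_fintype_card, Fintype.card_subtype, Finset.card_filter]
  push_cast
  refine Finset.sum_congr rfl fun t _ => ?_
  by_cases h : y t ∈ s t <;> simp [h]

lemma exp_natCard_le {s : τ → Set β} (y : τ → β) :
    Real.exp (Nat.card {t // y t ∈ s t}) ≤ Real.exp (Fintype.card τ) := by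
  rw [Real.exp_le_exp, ← Nat.card_eq_fintype_card]
  exact_mod_cast Finite.card_subtype_le _

variable [MeasurableSpace β] [MeasurableSpace Ω]

lemma measurable_natCard_mem {s : τ → Set β} (hs : ∀ t, MeasurableSet (s t)) {Y : τ → Ω → β}
    (hY : ∀ t, Measurable (Y t)) :
    Measurable fun ω => (Nat.card {t // Y t ω ∈ s t} : ℝ) := by
  simp only [natCard_eq_sum_indicator s]
  exact Finset.measurable_sum _ fun t _ =>
    (measurable_const.indicator (hs t)).comp (hY t)

lemma measurable_maxHits {S : τ → J → Set β} (hS : ∀ t j, MeasurableSet (S t j))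
    {Y : τ → Ω → β} (hY : ∀ t, Measurable (Y t)) :
    Measurable fun ω => (maxHits S fun t => Y t ω : ℝ) := by
  refine measurable_of_Iic fun c => ?_
  by_cases hc : 0 ≤ c
  · have : (fun ω => (maxHits S fun t => Y t ω : ℝ)) ⁻¹' Set.Iic c
        = ⋂ j, (fun ω => (Nat.card {t // Y t ω ∈ S t j} : ℝ)) ⁻¹' Set.Iic c := by
      ext ω
      simp only [Set.mem_preimage, Set.mem_Iic, Set.mem_iInter, ← Nat.le_floor_iff hc, maxHits,
        Finset.sup_le_iff, Finset.mem_univ, true_imp_iff]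
    rw [this]
    exact MeasurableSet.iInter fun j =>
      measurable_natCard_mem (fun t => hS t j) hY measurableSet_Iic
  · convert MeasurableSet.empty
    ext ω
    simp only [Set.mem_preimage, Set.mem_Iic, Set.mem_empty_iff_false, iff_false, not_le]
    exact (not_le.1 hc).trans_le (Nat.cast_nonneg _)

variable {P : Measure Ω} [IsProbabilityMeasure P]

lemma integrable_maxHits {S : τ → J → Set β} (hS : ∀ t j, MeasurableSet (S t j))
    {Y : τ → Ω → β} (hY : ∀ t, Measurable (Y t)) :
    Integrable (fun ω => (maxHits S fun t => Y t ω : ℝ)) P := by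
  refine .of_bound (measurable_maxHits hS hY).aestronglyMeasurable (Fintype.card τ)
    (.of_forall fun ω => ?_)
  rw [Real.norm_natCast]
  exact_mod_cast maxHits_le_card S _

lemma integral_exp_natCard_le {s : τ → Set β} (hs : ∀ t, MeasurableSet (s t)) {Y : τ → Ω → β}
    (hY : ∀ t, Measurable (Y t)) (hind : iIndepFun Y P) {q : ℝ}
    (hq : ∀ t, P.real (Y t ⁻¹' s t) ≤ q) :
    ∫ ω, Real.exp (Nat.card {t // Y t ω ∈ s t}) ∂P ≤ Real.exp (2 * q * Fintype.card τ) := by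
  set X : τ → Ω → ℝ := fun t ω => (s t).indicator (fun _ => (1 : ℝ)) (Y t ω) with hX
  have hm : ∀ t, Measurable ((s t).indicator fun _ => (1 : ℝ)) := fun t =>
    measurable_const.indicator (hs t)
  have hXm : ∀ t, Measurable (X t) := fun t => (hm t).comp (hY t)
  have hXi : iIndepFun X P := hind.comp _ hm
  have h := hXi.mgf_sum hXm Finset.univ (t := 1)
  have e : ∫ ω, Real.exp (Nat.card {t // Y t ω ∈ s t}) ∂P = mgf (∑ t, X t) P 1 := by
    simp only [mgf, one_mul, Finset.sum_apply, natCard_eq_sum_indicator s, hX]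
  rw [e, h]
  have hb : ∀ t ∈ Finset.univ, mgf (X t) P 1 ≤ Real.exp (2 * q) := by
    intro t _
    have h1 : ∀ ω, Real.exp (1 * X t ω)
        = 1 + (Y t ⁻¹' s t).indicator (fun _ => Real.exp 1 - 1) ω := by
      intro ω
      by_cases h : Y t ω ∈ s t
      · simp [hX, h]
      · simp [hX, h]
    have hmeas : MeasurableSet (Y t ⁻¹' s t) := hY t (hs t)
    have h2 : mgf (X t) P 1 = 1 + P.real (Y t ⁻¹' s t) * (Real.exp 1 - 1) := by
      simp only [mgf, h1]
      rw [integral_add (integrable_const _) ((integrable_const _).indicator hmeas),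
        integral_indicator_const _ hmeas]
      simp
    have h3 : P.real (Y t ⁻¹' s t) * (Real.exp 1 - 1) ≤ q * 2 :=
      mul_le_mul (hq t) (by linarith [Real.exp_one_lt_three])
        (by linarith [Real.add_one_le_exp (1 : ℝ)]) (measureReal_nonneg.trans (hq t))
    rw [h2]
    linarith [Real.add_one_le_exp (2 * q)]
  refine (Finset.prod_le_prod (fun t _ => mgf_nonneg) hb).trans (le_of_eq ?_)
  rw [Finset.prod_const, ← Real.exp_nat_mul, Finset.card_univ]
  ring_nf

/-- If each of the events of one round has probability at most `q` and the rounds are independent,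
then the expected maximal number of occurrences is at most logarithmic in the number of events,
up to the mean number of occurrences of a single event. -/
theorem integral_maxHits_le [Nonempty J] {S : τ → J → Set β}
    (hS : ∀ t j, MeasurableSet (S t j)) {Y : τ → Ω → β} (hY : ∀ t, Measurable (Y t))
    (hind : iIndepFun Y P) {q : ℝ} (hq : ∀ t j, P.real (Y t ⁻¹' S t j) ≤ q) :
    ∫ ω, (maxHits S fun t => Y t ω : ℝ) ∂P
      ≤ Real.log (Fintype.card J) + 2 * q * Fintype.card τ := by
  set c := Real.log (Fintype.card J) + 2 * q * Fintype.card τ with hc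
  have hJ : (0 : ℝ) < Fintype.card J := by exact_mod_cast Fintype.card_pos
  have hint : ∀ j, Integrable (fun ω => Real.exp (Nat.card {t // Y t ω ∈ S t j})) P := by
    intro j
    refine .of_bound (Real.measurable_exp.comp (measurable_natCard_mem (fun t => hS t j)
      hY)).aestronglyMeasurable (Real.exp (Fintype.card τ)) (.of_forall fun ω => ?_)
    rw [Real.norm_eq_abs, abs_of_pos (Real.exp_pos _)]
    exact exp_natCard_le _
  have hle : ∀ ω, (maxHits S fun t => Y t ω : ℝ)
      ≤ (c - 1) + Real.exp (-c) * ∑ j, Real.exp (Nat.card {t // Y t ω ∈ S t j}) := by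
    intro ω
    obtain ⟨j, hj⟩ := exists_maxHits_eq S (fun t => Y t ω)
    have h1 := Finset.single_le_sum
      (f := fun j => Real.exp (Nat.card {t // Y t ω ∈ S t j}))
      (fun j _ => (Real.exp_pos _).le) (Finset.mem_univ j)
    have h2 := mul_le_mul_of_nonneg_left h1 (Real.exp_pos (-c)).le
    simp only [← hj, ← Real.exp_add] at h2
    linarith [Real.add_one_le_exp (-c + (maxHits S fun t => Y t ω : ℝ))]
  calc ∫ ω, (maxHits S fun t => Y t ω : ℝ) ∂P
      ≤ ∫ ω, (c - 1) + Real.exp (-c) * ∑ j, Real.exp (Nat.card {t // Y t ω ∈ S t j}) ∂P :=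
        integral_mono (integrable_maxHits hS hY) ((integrable_const _).add
          ((integrable_finsetSum _ fun j _ => hint j).const_mul _)) hle
    _ = (c - 1) + Real.exp (-c) * ∑ j, ∫ ω, Real.exp (Nat.card {t // Y t ω ∈ S t j}) ∂P := by
        rw [integral_add (integrable_const _)
          ((integrable_finsetSum _ fun j _ => hint j).const_mul _), integral_const_mul,
          integral_finsetSum _ fun j _ => hint j]
        simp
    _ ≤ (c - 1) + Real.exp (-c) * ∑ _j : J, Real.exp (2 * q * Fintype.card τ) := by
        gcongr with j
        exact integral_exp_natCard_le (fun t => hS t j) hY hind fun t => hq t j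
    _ = c := by
        rw [Finset.sum_const, nsmul_eq_mul, Finset.card_univ, hc, neg_add, Real.exp_add,
          Real.exp_neg, Real.exp_log hJ, Real.exp_neg]
        field_simp
        ring

end MaxHits

/-! ### Exponential weights -/

lemma Real.exp_neg_le_one_sub_add_sq {x : ℝ} (hx : 0 ≤ x) : Real.exp (-x) ≤ 1 - x + x ^ 2 := by
  rw [Real.exp_neg, inv_le_iff_one_le_mul₀ (Real.exp_pos x)]
  have h : 0 ≤ 1 - x + x ^ 2 := by nlinarith [sq_nonneg (x - 1)]
  calc (1 : ℝ) ≤ (1 - x + x ^ 2) * (x + 1) := by nlinarith [pow_nonneg hx 3]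
    _ ≤ _ := mul_le_mul_of_nonneg_left (Real.add_one_le_exp x) h

section Hedge

variable {J : Type*} [Fintype J]

/-- The probability that the exponential weights algorithm with learning rate `η` gives to the
expert `j` when `c` is the vector of the cumulative losses. -/
noncomputable def hedgeWeight (η : ℝ) (c : J → ℝ) (j : J) : ℝ :=
  Real.exp (-η * c j) / ∑ k, Real.exp (-η * c k)

lemma sum_exp_pos [Nonempty J] (η : ℝ) (c : J → ℝ) : 0 < ∑ k, Real.exp (-η * c k) :=
  Finset.sum_pos (fun _ _ => Real.exp_pos _) Finset.univ_nonempty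

lemma hedgeWeight_nonneg (η : ℝ) (c : J → ℝ) (j : J) : 0 ≤ hedgeWeight η c j :=
  div_nonneg (Real.exp_pos _).le (Finset.sum_nonneg fun _ _ => (Real.exp_pos _).le)

lemma sum_hedgeWeight [Nonempty J] (η : ℝ) (c : J → ℝ) : ∑ j, hedgeWeight η c j = 1 := by
  simp only [hedgeWeight, ← Finset.sum_div]
  exact div_self (sum_exp_pos η c).ne'

lemma sum_exp_add_le [Nonempty J] {η B : ℝ} (hη : 0 ≤ η) (c l : J → ℝ) (h0 : ∀ j, 0 ≤ l j)
    (hB : ∀ j, l j ≤ B) :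
    ∑ j, Real.exp (-η * (c j + l j)) ≤ (∑ j, Real.exp (-η * c j))
      * Real.exp (-η * (∑ j, hedgeWeight η c j * l j) + η ^ 2 * B ^ 2) := by
  set W := ∑ j, Real.exp (-η * c j) with hW
  have hWpos : 0 < W := sum_exp_pos η c
  have hw : ∀ j, Real.exp (-η * c j) = W * hedgeWeight η c j := by
    intro j
    rw [hedgeWeight, ← hW, mul_div_cancel₀ _ hWpos.ne']
  have h1 : ∀ j, Real.exp (-η * (c j + l j))
      ≤ W * (hedgeWeight η c j - η * (hedgeWeight η c j * l j)
        + η ^ 2 * B ^ 2 * hedgeWeight η c j) := by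
    intro j
    have hx := Real.exp_neg_le_one_sub_add_sq (mul_nonneg hη (h0 j))
    have hsq : (η * l j) ^ 2 ≤ η ^ 2 * B ^ 2 := by
      rw [mul_pow]
      gcongr
      · exact h0 j
      · exact hB j
    have : -η * (c j + l j) = -η * c j + -(η * l j) := by ring
    rw [this, Real.exp_add, hw]
    calc W * hedgeWeight η c j * Real.exp (-(η * l j))
        ≤ W * hedgeWeight η c j * (1 - η * l j + η ^ 2 * B ^ 2) :=
          mul_le_mul_of_nonneg_left (by linarith) (mul_nonneg hWpos.le (hedgeWeight_nonneg _ _ _))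
      _ = _ := by ring
  refine (Finset.sum_le_sum fun j _ => h1 j).trans ?_
  rw [← Finset.mul_sum, Finset.sum_add_distrib, Finset.sum_sub_distrib, ← Finset.mul_sum,
    ← Finset.mul_sum, sum_hedgeWeight]
  refine mul_le_mul_of_nonneg_left ?_ hWpos.le
  linarith [Real.add_one_le_exp (-η * (∑ j, hedgeWeight η c j * l j) + η ^ 2 * B ^ 2)]

/-- The regret bound of the exponential weights algorithm. -/
theorem hedge_regret_le [Nonempty J] {η B : ℝ} (hη : 0 < η) (l : ℕ → J → ℝ) (T : ℕ)
    (h0 : ∀ t < T, ∀ j, 0 ≤ l t j) (hB : ∀ t < T, ∀ j, l t j ≤ B) (j₀ : J) :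
    ∑ t ∈ Finset.range T, ∑ j, hedgeWeight η (fun k => ∑ s ∈ Finset.range t, l s k) j * l t j
      ≤ ∑ t ∈ Finset.range T, l t j₀ + Real.log (Fintype.card J) / η + η * T * B ^ 2 := by
  have key : ∀ S ≤ T, ∑ j, Real.exp (-η * ∑ s ∈ Finset.range S, l s j)
      ≤ Fintype.card J * Real.exp (-η * (∑ t ∈ Finset.range S, ∑ j,
        hedgeWeight η (fun k => ∑ s ∈ Finset.range t, l s k) j * l t j) + S * (η ^ 2 * B ^ 2)) := by
    intro S
    induction S with
    | zero => intro _; simp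
    | succ S ih =>
      intro hS
      have h := sum_exp_add_le hη.le (fun j => ∑ s ∈ Finset.range S, l s j) (l S)
        (h0 S hS) (hB S hS)
      simp only [Finset.sum_range_succ]
      refine h.trans ((mul_le_mul_of_nonneg_right (ih (Nat.le_of_succ_le hS))
        (Real.exp_pos _).le).trans (le_of_eq ?_))
      rw [mul_assoc, ← Real.exp_add]
      push_cast
      ring_nf
  have h1 := (Finset.single_le_sum (f := fun j => Real.exp (-η * ∑ s ∈ Finset.range T, l s j))
    (fun _ _ => (Real.exp_pos _).le) (Finset.mem_univ j₀)).trans (key T le_rfl)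
  have hJ : (0 : ℝ) < Fintype.card J := by exact_mod_cast Fintype.card_pos
  have h2 := Real.log_le_log (Real.exp_pos _) h1
  rw [Real.log_exp, Real.log_mul hJ.ne' (Real.exp_pos _).ne', Real.log_exp] at h2
  have h3 : η * (Real.log (Fintype.card J) / η) = Real.log (Fintype.card J) := by field_simp
  refine le_of_mul_le_mul_left ?_ hη
  rw [mul_add, mul_add, h3]
  linarith

end Hedge

/-! ### Measurability of projections -/

section Projection

variable {X Y Z : Type*} [TopologicalSpace X] [TopologicalSpace Y] [TopologicalSpace Z]

/-- The projection of a countable union of closed sets along a `σ`-compact space is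
measurable. -/
lemma measurableSet_image_fst_of_isGδ_compl [SigmaCompactSpace X] [T2Space X] [MeasurableSpace X]
    [BorelSpace X] [SigmaCompactSpace Y] {E : Set (X × Y)} (hE : IsGδ Eᶜ) :
    MeasurableSet (Prod.fst '' E) := by
  obtain ⟨f, hf, he⟩ := isGδ_iff_eq_iInter_nat.1 hE
  have hEu : E = ⋃ k, (f k)ᶜ := by rw [← compl_compl E, he, Set.compl_iInter]
  have hσ : IsSigmaCompact E := by
    rw [hEu]
    exact isSigmaCompact_iUnion _ fun k =>
      isSigmaCompact_univ.of_isClosed_subset (hf k).isClosed_compl (Set.subset_univ _)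
  obtain ⟨K, hK, hKe⟩ := hσ.image continuous_fst
  rw [← hKe]
  exact MeasurableSet.iUnion fun k => (hK k).measurableSet

/-- `f` coincides with a continuous function on each set of a finite cover by countable unions of
closed sets. -/
def IsPiecewiseContinuous (f : X → Y) : Prop :=
  ∃ (ι : Type) (_ : Finite ι) (A : ι → Set X) (g : ι → X → Y), (∀ i, IsGδ (A i)ᶜ) ∧
    (∀ i, Continuous (g i)) ∧ (∀ i, Set.EqOn f (g i) (A i)) ∧ ∀ x, ∃ i, x ∈ A i

namespace IsPiecewiseContinuous

lemma comp_continuous {f : X → Y} (hf : IsPiecewiseContinuous f) {h : Z → X}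
    (hh : Continuous h) : IsPiecewiseContinuous fun z => f (h z) := by
  obtain ⟨ι, hι, A, g, hA, hg, hfg, hc⟩ := hf
  exact ⟨ι, hι, fun i => h ⁻¹' A i, fun i z => g i (h z), fun i => (hA i).preimage hh,
    fun i => (hg i).comp hh, fun i z hz => hfg i hz, fun z => hc (h z)⟩

lemma continuous_comp {f : X → Y} (hf : IsPiecewiseContinuous f) {h : Y → Z}
    (hh : Continuous h) : IsPiecewiseContinuous fun x => h (f x) := by
  obtain ⟨ι, hι, A, g, hA, hg, hfg, hc⟩ := hf
  exact ⟨ι, hι, A, fun i z => h (g i z), hA, fun i => hh.comp (hg i),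
    fun i z hz => congrArg h (hfg i hz), hc⟩

lemma pi {T : ℕ} {f : Fin T → X → Y} (hf : ∀ t, IsPiecewiseContinuous (f t)) :
    IsPiecewiseContinuous fun x t => f t x := by
  choose ι hι A g hA hg hfg hc using hf
  refine ⟨∀ t, ι t, inferInstance, fun i => ⋂ t, A t (i t), fun i x t => g t (i t) x,
    fun i => ?_, fun i => continuous_pi fun t => hg t (i t), fun i x hx => ?_, fun x => ?_⟩
  · rw [Set.compl_iInter]
    exact .iUnion fun t => hA t (i t)
  · exact funext fun t => hfg t (i t) (Set.mem_iInter.1 hx t)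
  · exact ⟨fun t => (hc t x).choose, Set.mem_iInter.2 fun t => (hc t x).choose_spec⟩

lemma prodMk {f : X → Y} {g : X → Z} (hf : IsPiecewiseContinuous f)
    (hg : IsPiecewiseContinuous g) : IsPiecewiseContinuous fun x => (f x, g x) := by
  obtain ⟨ι, hι, A, f', hA, hf', hff, hc⟩ := hf
  obtain ⟨κ, hκ, B, g', hB, hg', hgg, hd⟩ := hg
  refine ⟨ι × κ, inferInstance, fun i => A i.1 ∩ B i.2, fun i x => (f' i.1 x, g' i.2 x),
    fun i => ?_, fun i => (hf' i.1).prodMk (hg' i.2), fun i x hx => ?_, fun x => ?_⟩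
  · rw [Set.compl_inter]
    exact (hA _).union (hB _)
  · exact Prod.ext (hff _ hx.1) (hgg _ hx.2)
  · exact ⟨((hc x).choose, (hd x).choose), (hc x).choose_spec, (hd x).choose_spec⟩

lemma isGδ_compl_preimage {Y : Type*} [PseudoMetricSpace Y] {f : X → Y}
    (hf : IsPiecewiseContinuous f) {U : Set Y} (hU : IsOpen U) : IsGδ (f ⁻¹' U)ᶜ := by
  obtain ⟨ι, hι, A, g, hA, hg, hfg, hc⟩ := hf
  have : f ⁻¹' U = ⋃ i, A i ∩ g i ⁻¹' U := by
    ext x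
    simp only [Set.mem_preimage, Set.mem_iUnion, Set.mem_inter_iff]
    constructor
    · intro hx
      obtain ⟨i, hi⟩ := hc x
      exact ⟨i, hi, by rwa [← hfg i hi]⟩
    · rintro ⟨i, hi, hx⟩
      rwa [hfg i hi]
  rw [this, Set.compl_iUnion]
  refine .iInter fun i => ?_
  rw [Set.compl_inter]
  exact (hA i).union ((hU.isClosed_compl.isGδ).preimage (hg i))

end IsPiecewiseContinuous

end Projection

/-! ### Equilibria and losses -/

namespace ComponentGame

variable {n : ℕ}

/-- The subsidy at which agent `i` is indifferent between its two actions, when the other agents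
act by `s`. -/
noncomputable def threshold (G : ComponentGame n) (s : Fin n → Bool) (i : Fin n) : ℝ :=
  G.repairCost i
    - (G.workingProb (Function.update s i true) - G.workingProb (Function.update s i false))

lemma isNash_iff (G : ComponentGame n) (σ : EuclideanSpace ℝ (Fin n)) (s : Fin n → Bool) :
    G.IsNash σ s ↔
      ∀ i, (s i = true → G.threshold s i ≤ σ i) ∧ (s i = false → σ i ≤ G.threshold s i) := by
  refine forall_congr' fun i => ?_
  have hs : Function.update s i (s i) = s := Function.update_eq_self i s
  simp only [Bool.forall_bool, subsidizedCost, cost, subs, threshold, Function.update_self]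
  cases h : s i <;> rw [h] at hs <;> simp only [hs] <;> constructor <;> intro h1 <;>
    simp at h1 ⊢ <;> linarith

/-- The social cost of the game without subsidies. -/
noncomputable def socialCost (G : ComponentGame n) (s : Fin n → Bool) : ℝ := ∑ i, G.cost s i

lemma loss_eq (G : ComponentGame n) (σ : EuclideanSpace ℝ (Fin n)) :
    G.loss σ = (G.nashSet σ).sup' (G.nashSet_nonempty σ) G.socialCost := by
  refine Finset.sup'_congr _ rfl fun s _ => ?_
  rw [socialCost, ← Finset.sum_add_distrib]
  exact Finset.sum_congr rfl fun i _ => by rw [subsidizedCost]; ring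

lemma mem_nashSet {G : ComponentGame n} {σ : EuclideanSpace ℝ (Fin n)} {s : Fin n → Bool} :
    s ∈ G.nashSet σ ↔ G.IsNash σ s := by simp [nashSet]

lemma loss_le_iff (G : ComponentGame n) (σ : EuclideanSpace ℝ (Fin n)) (c : ℝ) :
    G.loss σ ≤ c ↔ ∀ s, G.IsNash σ s → G.socialCost s ≤ c := by
  simp [loss_eq, mem_nashSet]

lemma loss_congr (G : ComponentGame n) {σ σ' : EuclideanSpace ℝ (Fin n)}
    (h : ∀ s, G.IsNash σ s ↔ G.IsNash σ' s) : G.loss σ = G.loss σ' :=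
  eq_of_forall_ge_iff fun c => by simp only [loss_le_iff, h]

/-- Some threshold of the game for some agent `i` lies in `I i`. -/
def Crosses (G : ComponentGame n) (I : Fin n → Set ℝ) : Prop :=
  ∃ s i, G.threshold s i ∈ I i

lemma loss_eq_of_not_crosses (G : ComponentGame n) {I : Fin n → Set ℝ}
    (hI : ∀ i, (I i).OrdConnected) (h : ¬ G.Crosses I) {σ σ' : EuclideanSpace ℝ (Fin n)}
    (hσ : ∀ i, σ i ∈ I i) (hσ' : ∀ i, σ' i ∈ I i) : G.loss σ = G.loss σ' := by
  have h' : ∀ s i, G.threshold s i ∉ I i := fun s i hi => h ⟨s, i, hi⟩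
  refine G.loss_congr fun s => ?_
  simp only [isNash_iff]
  refine forall_congr' fun i => ?_
  have h1 := h' s i
  refine and_congr (imp_congr_right fun _ => ⟨fun h2 => ?_, fun h2 => ?_⟩)
    (imp_congr_right fun _ => ⟨fun h2 => ?_, fun h2 => ?_⟩)
  · by_contra! h3; exact h1 ((hI i).out (hσ' i) (hσ i) ⟨h3.le, h2⟩)
  · by_contra! h3; exact h1 ((hI i).out (hσ i) (hσ' i) ⟨h3.le, h2⟩)
  · by_contra! h3; exact h1 ((hI i).out (hσ i) (hσ' i) ⟨h2, h3.le⟩)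
  · by_contra! h3; exact h1 ((hI i).out (hσ' i) (hσ i) ⟨h2, h3.le⟩)

lemma prior_nonneg (G : ComponentGame n) (x : Fin n → Bool) : 0 ≤ G.prior x :=
  Finset.prod_nonneg fun i _ => by
    split_ifs
    · exact (G.workProb i).2.1
    · linarith [(G.workProb i).2.2]

lemma workingProb_nonneg (G : ComponentGame n) (s : Fin n → Bool) : 0 ≤ G.workingProb s :=
  Finset.sum_nonneg fun x _ => mul_nonneg (G.prior_nonneg x) (by split_ifs <;> norm_num)

lemma socialCost_le (G : ComponentGame n) {H : ℝ} (hH : 0 ≤ H) (hG : ∀ i, G.repairCost i ≤ H)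
    (s : Fin n → Bool) : G.socialCost s ≤ (2 * H + 1) * n := by
  have : ∀ i ∈ Finset.univ, G.cost s i ≤ 2 * H + 1 := fun i _ => by
    have := G.workingProb_nonneg s
    have := hG i
    rw [cost]
    split_ifs <;> linarith
  refine (Finset.sum_le_sum this).trans (le_of_eq ?_)
  rw [Finset.sum_const, nsmul_eq_mul, Finset.card_univ, Fintype.card_fin, mul_comm]

lemma loss_le (G : ComponentGame n) {H : ℝ} (hH : 0 ≤ H) (hG : ∀ i, G.repairCost i ≤ H)
    (σ : EuclideanSpace ℝ (Fin n)) : G.loss σ ≤ (2 * H + 1) * n :=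
  (G.loss_le_iff σ _).2 fun s _ => G.socialCost_le hH hG s

lemma exists_forall_le_loss (G : ComponentGame n) :
    ∃ c, ∀ σ : EuclideanSpace ℝ (Fin n), c ≤ G.loss σ := by
  obtain ⟨s₀, hs₀⟩ := Finite.exists_min G.socialCost
  refine ⟨G.socialCost s₀, fun σ => ?_⟩
  obtain ⟨s, hs⟩ := G.nashSet_nonempty σ
  exact (hs₀ s).trans ((G.loss_le_iff σ _).1 le_rfl s (mem_nashSet.1 hs))

/-! ### Dependence on the repair costs -/

/-- The game with given costs, prior and system function. -/
def ofCost (w : Fin n → unitInterval) (φ : (Fin n → Bool) → Bool) (C : Fin n → ℝ) :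
    ComponentGame n := ⟨C, w, φ⟩

lemma workingProb_ofCost (w : Fin n → unitInterval) (φ : (Fin n → Bool) → Bool)
    (C C' : Fin n → ℝ) (s : Fin n → Bool) :
    (ofCost w φ C).workingProb s = (ofCost w φ C').workingProb s := rfl

lemma threshold_ofCost (w : Fin n → unitInterval) (φ : (Fin n → Bool) → Bool) (C : Fin n → ℝ)
    (s : Fin n → Bool) (i : Fin n) :
    (ofCost w φ C).threshold s i = C i + (ofCost w φ 0).threshold s i := by
  rw [threshold, threshold, workingProb_ofCost w φ C 0, workingProb_ofCost w φ C 0]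
  change C i - _ = C i + (0 - _)
  ring

lemma continuous_threshold_ofCost (w : Fin n → unitInterval) (φ : (Fin n → Bool) → Bool)
    (s : Fin n → Bool) (i : Fin n) : Continuous fun C => (ofCost w φ C).threshold s i := by
  rw [funext fun C => threshold_ofCost w φ C s i]
  fun_prop

lemma continuous_socialCost_ofCost (w : Fin n → unitInterval) (φ : (Fin n → Bool) → Bool)
    (s : Fin n → Bool) : Continuous fun C => (ofCost w φ C).socialCost s := by
  refine continuous_finsetSum _ fun i _ => ?_
  change Continuous fun C : Fin n → ℝ =>
    (if s i then C i else 0) + 1 - (ofCost w φ 0).workingProb s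
  split_ifs <;> fun_prop

lemma isClosed_isNash_ofCost (w : Fin n → unitInterval) (φ : (Fin n → Bool) → Bool)
    (s : Fin n → Bool) :
    IsClosed {x : (Fin n → ℝ) × EuclideanSpace ℝ (Fin n) | (ofCost w φ x.1).IsNash x.2 s} := by
  simp only [isNash_iff, Set.ofPred_forall, Set.ofPred_and]
  have h1 : ∀ i, Continuous fun x : (Fin n → ℝ) × EuclideanSpace ℝ (Fin n) =>
      (ofCost w φ x.1).threshold s i := fun i =>
    (continuous_threshold_ofCost w φ s i).comp continuous_fst
  refine isClosed_iInter fun i => IsClosed.inter ?_ ?_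
  · exact isClosed_iInter fun _ => isClosed_le (h1 i) (by fun_prop)
  · exact isClosed_iInter fun _ => isClosed_le (by fun_prop) (h1 i)

lemma isPiecewiseContinuous_loss (w : Fin n → unitInterval) (φ : (Fin n → Bool) → Bool) :
    IsPiecewiseContinuous fun x : (Fin n → ℝ) × EuclideanSpace ℝ (Fin n) =>
      (ofCost w φ x.1).loss x.2 := by
  classical
  refine ⟨{N : Finset (Fin n → Bool) // N.Nonempty}, inferInstance,
    fun N => {x | (ofCost w φ x.1).nashSet x.2 = N},
    fun N x => N.1.sup' N.2 (ofCost w φ x.1).socialCost, fun N => ?_, fun N => ?_, fun N x hx => ?_,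
    fun x => ⟨⟨_, nashSet_nonempty _ _⟩, rfl⟩⟩
  · have : {x : (Fin n → ℝ) × EuclideanSpace ℝ (Fin n) | (ofCost w φ x.1).nashSet x.2 = N}
        = ⋂ s, if s ∈ N.1 then {x | (ofCost w φ x.1).IsNash x.2 s}
            else {x | (ofCost w φ x.1).IsNash x.2 s}ᶜ := by
      ext x
      simp only [Set.mem_ofPred_eq, Set.mem_iInter, Finset.ext_iff, mem_nashSet]
      refine forall_congr' fun s => ?_
      by_cases hs : s ∈ N.1 <;> simp [hs]
    beta_reduce
    rw [this, Set.compl_iInter]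
    refine .iUnion fun s => ?_
    have hc := isClosed_isNash_ofCost w φ s
    split_ifs
    · exact hc.isOpen_compl.isGδ
    · rw [compl_compl]
      exact hc.isGδ
  · exact Continuous.finset_sup'_apply N.2 fun s _ =>
      (continuous_socialCost_ofCost w φ s).comp continuous_fst
  · simp only [Set.mem_ofPred_eq] at hx
    simp only [loss_eq, hx]

/-! ### Measurability -/

lemma measurable_toTuple : Measurable (toTuple : ComponentGame n → _) :=
  comap_measurable _

lemma measurable_workingProb (s : Fin n → Bool) :
    Measurable fun G : ComponentGame n => G.workingProb s := by
  have hw : ∀ i, Measurable fun G : ComponentGame n => (G.workProb i : ℝ) := fun i =>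
    measurable_subtype_coe.comp ((measurable_pi_apply i).comp
      (measurable_fst.comp (measurable_snd.comp measurable_toTuple)))
  have hφ : ∀ x, Measurable fun G : ComponentGame n => G.system x := fun x =>
    (measurable_pi_apply x).comp (measurable_snd.comp (measurable_snd.comp measurable_toTuple))
  refine Finset.measurable_sum _ fun x _ => .mul ?_ ?_
  · refine Finset.measurable_prod _ fun i _ => ?_
    split_ifs
    · exact hw i
    · exact measurable_const.sub (hw i)
  · exact .ite (hφ _ (measurableSet_singleton true)) measurable_const measurable_const

lemma measurable_repairCost (i : Fin n) :
    Measurable fun G : ComponentGame n => G.repairCost i :=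
  (measurable_pi_apply i).comp (measurable_fst.comp measurable_toTuple)

lemma measurable_loss (σ : EuclideanSpace ℝ (Fin n)) :
    Measurable fun G : ComponentGame n => G.loss σ := by
  have ht : ∀ s i, Measurable fun G : ComponentGame n => G.threshold s i := fun s i =>
    (measurable_repairCost i).sub ((measurable_workingProb _).sub (measurable_workingProb _))
  have hs : ∀ s, Measurable fun G : ComponentGame n => G.socialCost s := fun s => by
    refine Finset.measurable_sum _ fun i _ => ?_
    simp only [cost]
    refine (Measurable.add ?_ measurable_const).sub (measurable_workingProb s)
    split_ifs
    · exact measurable_repairCost i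
    · exact measurable_const
  refine measurable_of_Iic fun c => ?_
  simp only [Set.preimage, Set.mem_Iic, loss_le_iff, isNash_iff]
  refine measurableSet_setOfPred.2 (.forall fun s => .imp (.forall fun i => .and ?_ ?_) ?_)
  · exact .imp measurable_const (measurableSet_setOfPred.1 (measurableSet_le (ht s i) measurable_const))
  · exact .imp measurable_const (measurableSet_setOfPred.1 (measurableSet_le measurable_const (ht s i)))
  · exact measurableSet_setOfPred.1 (measurableSet_le (hs s) measurable_const)

end ComponentGame

/-! ### Measurability of the number of violations of the Lipschitz condition -/

section NonLipschitzCount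

variable {E X : Type*} [PseudoMetricSpace E] {T : ℕ}

lemma nonLipschitzCount_le {D : Set E} {L : Fin T → E → ℝ} {ℓ ε : ℝ} {N : ℕ}
    (h : ∀ ρ ∈ D, ∀ ρ' ∈ D, dist ρ ρ' ≤ ε →
      Nat.card {t : Fin T // ℓ * dist ρ ρ' < |L t ρ - L t ρ'|} ≤ N) :
    nonLipschitzCount D L ℓ ε ≤ N := by
  refine csSup_le' ?_
  rintro k ⟨ρ, hρ, ρ', hρ', hd, rfl⟩
  exact h ρ hρ ρ' hρ' hd

lemma nonLipschitzCount_le_card (D : Set E) (L : Fin T → E → ℝ) (ℓ ε : ℝ) :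
    nonLipschitzCount D L ℓ ε ≤ T :=
  nonLipschitzCount_le fun ρ _ ρ' _ _ => by
    simpa using Finite.card_subtype_le fun t : Fin T => ℓ * dist ρ ρ' < |L t ρ - L t ρ'|

lemma le_nonLipschitzCount_iff {D : Set E} (hD : D.Nonempty) (L : Fin T → E → ℝ) (ℓ : ℝ) {ε : ℝ}
    (hε : 0 ≤ ε) (k : ℕ) :
    k ≤ nonLipschitzCount D L ℓ ε ↔ ∃ ρ ∈ D, ∃ ρ' ∈ D, dist ρ ρ' ≤ ε ∧
      k ≤ Nat.card {t : Fin T // ℓ * dist ρ ρ' < |L t ρ - L t ρ'|} := by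
  have hbdd : BddAbove {k : ℕ | ∃ ρ ∈ D, ∃ ρ' ∈ D, dist ρ ρ' ≤ ε ∧
      k = Nat.card {t : Fin T // ℓ * dist ρ ρ' < |L t ρ - L t ρ'|}} := by
    refine ⟨T, ?_⟩
    rintro k ⟨ρ, -, ρ', -, -, rfl⟩
    simpa using Finite.card_subtype_le fun t : Fin T => ℓ * dist ρ ρ' < |L t ρ - L t ρ'|
  constructor
  · intro h
    obtain ⟨ρ₀, hρ₀⟩ := hD
    have hmem := fun hne => Nat.sSup_mem hne hbdd
    obtain ⟨ρ, hρ, ρ', hρ', hd, he⟩ :=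
      hmem ⟨_, ρ₀, hρ₀, ρ₀, hρ₀, (dist_self ρ₀).trans_le hε, rfl⟩
    exact ⟨ρ, hρ, ρ', hρ', hd, h.trans he.le⟩
  · rintro ⟨ρ, hρ, ρ', hρ', hd, h⟩
    exact h.trans (le_csSup hbdd ⟨ρ, hρ, ρ', hρ', hd, rfl⟩)

lemma isOpen_le_natCard {Y : Type*} [TopologicalSpace Y] {U : Fin T → Set Y}
    (hU : ∀ t, IsOpen (U t)) (k : ℕ) : IsOpen {y | k ≤ Nat.card {t // y ∈ U t}} := by
  classical
  have : {y | k ≤ Nat.card {t // y ∈ U t}}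
      = ⋃ S ∈ {S : Finset (Fin T) | k ≤ S.card}, ⋂ t ∈ S, U t := by
    ext y
    simp only [Set.mem_ofPred_eq, Set.mem_iUnion, Set.mem_iInter, exists_prop,
      Nat.card_eq_fintype_card, Fintype.card_subtype]
    refine ⟨fun h => ⟨_, h, by simp⟩, fun ⟨S, hS, h⟩ => hS.trans (Finset.card_le_card fun t ht => ?_)⟩
    simpa using h t ht
  rw [this]
  exact isOpen_biUnion fun S _ => isOpen_biInter_finset fun t _ => hU t

variable [TopologicalSpace X] [SigmaCompactSpace X] [T2Space X] [MeasurableSpace X] [BorelSpace X]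
  [SigmaCompactSpace E]

lemma measurable_nonLipschitzCount {D : Set E} (hD : IsClosed D) (hD' : D.Nonempty)
    {L : Fin T → X → E → ℝ} (hL : ∀ t, IsPiecewiseContinuous fun x : X × E => L t x.1 x.2)
    (ℓ : ℝ) {ε : ℝ} (hε : 0 ≤ ε) :
    Measurable fun x => nonLipschitzCount D (fun t => L t x) ℓ ε := by
  refine measurable_of_Ici fun k => ?_
  let F : X × E × E → (Fin T → ℝ) × (Fin T → ℝ) × ℝ := fun z =>
    ((fun t => L t z.1 z.2.1), (fun t => L t z.1 z.2.2), dist z.2.1 z.2.2)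
  have hF : IsPiecewiseContinuous F := by
    refine .prodMk (.pi fun t => ?_) (.prodMk (.pi fun t => ?_) ?_)
    · exact (hL t).comp_continuous (h := fun z : X × E × E => (z.1, z.2.1)) (by fun_prop)
    · exact (hL t).comp_continuous (h := fun z : X × E × E => (z.1, z.2.2)) (by fun_prop)
    · exact ⟨Unit, inferInstance, fun _ => Set.univ, fun _ z => dist z.2.1 z.2.2, fun _ => by simp,
        fun _ => by fun_prop, fun _ _ _ => rfl, fun z => ⟨(), trivial⟩⟩
  let U : Fin T → Set ((Fin T → ℝ) × (Fin T → ℝ) × ℝ) := fun t =>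
    {y | ℓ * y.2.2 < |y.1 t - y.2.1 t|}
  have hU : ∀ t, IsOpen (U t) := fun t => isOpen_lt (by fun_prop) (by fun_prop)
  let C : Set (X × E × E) := {z | z.2.1 ∈ D ∧ z.2.2 ∈ D ∧ dist z.2.1 z.2.2 ≤ ε}
  have hC : IsClosed C := by
    refine (hD.preimage (by fun_prop : Continuous fun z : X × E × E => z.2.1)).inter
      ((hD.preimage (by fun_prop : Continuous fun z : X × E × E => z.2.2)).inter ?_)
    exact isClosed_le (f := fun z : X × E × E => dist z.2.1 z.2.2) (by fun_prop) continuous_const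
  have hE : IsGδ (C ∩ F ⁻¹' {y | k ≤ Nat.card {t // y ∈ U t}})ᶜ := by
    rw [Set.compl_inter]
    exact hC.isOpen_compl.isGδ.union (hF.isGδ_compl_preimage (isOpen_le_natCard hU k))
  convert measurableSet_image_fst_of_isGδ_compl hE
  ext x
  simp only [Set.mem_preimage, Set.mem_Ici, le_nonLipschitzCount_iff hD' _ ℓ hε, Set.mem_image]
  constructor
  · rintro ⟨ρ, hρ, ρ', hρ', hd, h⟩
    exact ⟨(x, ρ, ρ'), ⟨⟨hρ, hρ', hd⟩, h⟩, rfl⟩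
  · rintro ⟨⟨_, ρ, ρ'⟩, ⟨⟨hρ, hρ', hd⟩, h⟩, rfl⟩
    exact ⟨ρ, hρ, ρ', hρ', hd, h⟩

/-- The infimum over a closed set of a finite sum of piecewise continuous functions is
measurable. -/
lemma measurable_iInf_sum {D : Set E} (hD : IsClosed D) (hD' : D.Nonempty)
    {L : Fin T → X → E → ℝ} (hL : ∀ t, IsPiecewiseContinuous fun x : X × E => L t x.1 x.2)
    (hb : ∀ t x, ∃ c, ∀ ρ, c ≤ L t x ρ) :
    Measurable fun x => ⨅ ρ : D, ∑ t, L t x ρ := by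
  have : Nonempty D := hD'.to_subtype
  refine measurable_of_Iio fun c => ?_
  have hF : IsPiecewiseContinuous fun z : X × E => ∑ t, L t z.1 z.2 :=
    (IsPiecewiseContinuous.pi hL).continuous_comp (h := fun y : Fin T → ℝ => ∑ t, y t)
      (by fun_prop)
  have hE : IsGδ (Prod.snd ⁻¹' D ∩ (fun z : X × E => ∑ t, L t z.1 z.2) ⁻¹' Set.Iio c)ᶜ := by
    rw [Set.compl_inter]
    exact (hD.preimage continuous_snd).isOpen_compl.isGδ.union
      (hF.isGδ_compl_preimage isOpen_Iio)
  convert measurableSet_image_fst_of_isGδ_compl hE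
  ext x
  choose b hbx using hb
  have hbdd : BddBelow (Set.range fun ρ : D => ∑ t, L t x ρ) :=
    ⟨∑ t, b t x, by
      rintro _ ⟨ρ, rfl⟩
      exact Finset.sum_le_sum fun t _ => hbx t x ρ⟩
  simp only [Set.mem_preimage, Set.mem_Iio, ciInf_lt_iff hbdd, Set.mem_image]
  constructor
  · rintro ⟨ρ, h⟩
    exact ⟨(x, ρ), ⟨ρ.2, h⟩, rfl⟩
  · rintro ⟨⟨_, ρ⟩, ⟨hρ, h⟩, rfl⟩
    exact ⟨⟨ρ, hρ⟩, h⟩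

end NonLipschitzCount

lemma isClosed_subsidyCube (n : ℕ) (H : ℝ) : IsClosed (subsidyCube n H) := by
  simp only [subsidyCube, Set.ofPred_forall]
  exact isClosed_iInter fun i => isClosed_Icc.preimage (by fun_prop)

lemma subsidyCube_nonempty (n : ℕ) {H : ℝ} (hH : 0 ≤ H) : (subsidyCube n H).Nonempty :=
  ⟨0, fun _ => ⟨le_rfl, hH⟩⟩

/-! ### Grids -/

/-- The closed box with sides of length `b` whose lower corner is the point `J` of the grid of
width `a`. -/
def gridCell {n m : ℕ} (a b : ℝ) (J : Fin n → Fin m) (i : Fin n) : Set ℝ :=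
  Set.Icc ((J i : ℝ) * a) ((J i : ℝ) * a + b)

lemma exists_lt_mul_le_le {H a x : ℝ} {m : ℕ} (ha : 0 < a) (hm : H ≤ m * a) (hm0 : 0 < m)
    (hx : x ∈ Set.Icc 0 H) : ∃ j : Fin m, (j : ℝ) * a ≤ x ∧ x ≤ (j : ℝ) * a + a := by
  by_cases h : ⌊x / a⌋₊ < m
  · refine ⟨⟨⌊x / a⌋₊, h⟩, ?_, ?_⟩
    · exact (le_div_iff₀ ha).1 (Nat.floor_le (div_nonneg hx.1 ha.le))
    · have := (div_lt_iff₀ ha).1 (Nat.lt_floor_add_one (x / a))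
      simp only
      linarith
  · have h1 : (m : ℝ) ≤ x / a := (Nat.le_floor_iff (div_nonneg hx.1 ha.le)).1 (not_lt.1 h)
    have h2 := (le_div_iff₀ ha).1 h1
    refine ⟨⟨m - 1, by omega⟩, ?_, ?_⟩ <;> rw [Nat.cast_sub hm0] <;> push_cast <;>
      linarith [hx.2]

namespace ComponentGame

variable {n m T : ℕ}

/-- The repair costs for which a threshold lies in the cell `J` of a grid, in each round. -/
def crossingCosts (w : Fin T → Fin n → unitInterval) (φ : Fin T → (Fin n → Bool) → Bool)
    (a b : ℝ) (t : Fin T) (J : Fin n → Fin m) : Set (Fin n → ℝ) :=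
  {C | (ofCost (w t) (φ t) C).Crosses (gridCell a b J)}

lemma measurableSet_crossingCosts (w : Fin T → Fin n → unitInterval)
    (φ : Fin T → (Fin n → Bool) → Bool) (a b : ℝ) (t : Fin T) (J : Fin n → Fin m) :
    MeasurableSet (crossingCosts w φ a b t J) := by
  simp only [crossingCosts, Crosses, Set.ofPred_exists]
  exact .iUnion fun s => .iUnion fun i =>
    (continuous_threshold_ofCost _ _ s i).measurable measurableSet_Icc

end ComponentGame

namespace IsSmoothGameSequence

open ComponentGame

variable {n m T : ℕ} {Ω : Type*} [MeasurableSpace Ω] {P : Measure Ω}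
  {H κ : ℝ} {G : Fin T → Ω → ComponentGame n} {w : Fin T → Fin n → unitInterval}
  {φ : Fin T → (Fin n → Bool) → Bool}

lemma eq_ofCost (hG : IsSmoothGameSequence P H κ G w φ) (t : Fin T) (ω : Ω) :
    G t ω = ofCost (w t) (φ t) (G t ω).repairCost :=
  ComponentGame.ext rfl (hG.workProb_eq t ω) (hG.system_eq t ω)

lemma measureReal_cost_le (hG : IsSmoothGameSequence P H κ G w φ) (hκ : 0 ≤ κ) (t : Fin T)
    (i : Fin n) (u : ℝ) {b : ℝ} (hb : 0 ≤ b) :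
    P.real {ω | (G t ω).repairCost i ∈ Set.Icc u (u + b)} ≤ κ * b := by
  obtain ⟨f, hf, hfκ, hPf⟩ := hG.bounded_density t i
  have hm : Measurable fun ω => (G t ω).repairCost i :=
    (measurable_pi_apply i).comp (hG.measurable_cost t)
  have h : P {ω | (G t ω).repairCost i ∈ Set.Icc u (u + b)} ≤ ENNReal.ofReal (κ * b) := by
    calc P {ω | (G t ω).repairCost i ∈ Set.Icc u (u + b)}
        = P.map (fun ω => (G t ω).repairCost i) (Set.Icc u (u + b)) :=
          (Measure.map_apply hm measurableSet_Icc).symm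
      _ = ∫⁻ x in Set.Icc u (u + b), f x := by
          rw [hPf, withDensity_apply _ measurableSet_Icc]
      _ ≤ ∫⁻ _ in Set.Icc u (u + b), ENNReal.ofReal κ := lintegral_mono fun x => hfκ x
      _ = ENNReal.ofReal (κ * b) := by
          rw [setLIntegral_const, Real.volume_Icc, add_sub_cancel_left, ← ENNReal.ofReal_mul hκ]
  exact ENNReal.toReal_le_of_le_ofReal (mul_nonneg hκ hb) h

lemma natCard_loss_ne_le (hG : IsSmoothGameSequence P H κ G w φ) (a b : ℝ) (J : Fin n → Fin m)
    (ω : Ω) {p : Fin T → Prop}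
    (hp : ∀ t, p t → ∃ ρ ρ' : EuclideanSpace ℝ (Fin n), (∀ i, ρ i ∈ gridCell a b J i) ∧
      (∀ i, ρ' i ∈ gridCell a b J i) ∧ (G t ω).loss ρ ≠ (G t ω).loss ρ') :
    Nat.card {t // p t} ≤ maxHits (crossingCosts (m := m) w φ a b) fun t => (G t ω).repairCost := by
  refine le_trans ?_ (card_le_maxHits _ _ J)
  refine Nat.card_le_card_of_injective (fun t => ⟨t.1, ?_⟩) fun t t' h => by
    simpa [Subtype.ext_iff] using h
  obtain ⟨ρ, ρ', h, h', hne⟩ := hp t.1 t.2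
  change (ofCost _ _ _).Crosses _
  rw [← hG.eq_ofCost]
  by_contra hc
  exact hne (loss_eq_of_not_crosses _ (fun i => Set.ordConnected_Icc) hc h h')

variable [IsProbabilityMeasure P]

lemma measureReal_crossing_le (hG : IsSmoothGameSequence P H κ G w φ) (hκ : 0 ≤ κ) (t : Fin T)
    (a : ℝ) {b : ℝ} (hb : 0 ≤ b) (J : Fin n → Fin m) :
    P.real ((fun ω => (G t ω).repairCost) ⁻¹' crossingCosts w φ a b t J)
      ≤ n * 2 ^ n * (κ * b) := by
  have hsub : (fun ω => (G t ω).repairCost) ⁻¹' crossingCosts w φ a b t J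
      ⊆ ⋃ si ∈ (Finset.univ : Finset ((Fin n → Bool) × Fin n)), {ω | (G t ω).repairCost si.2 ∈
        Set.Icc ((J si.2 : ℝ) * a - (ofCost (w t) (φ t) 0).threshold si.1 si.2)
          ((J si.2 : ℝ) * a - (ofCost (w t) (φ t) 0).threshold si.1 si.2 + b)} := by
    rintro ω ⟨s, i, hsi⟩
    rw [threshold_ofCost, gridCell, Set.mem_Icc] at hsi
    simp only [Finset.mem_univ, Set.iUnion_true, Set.mem_iUnion]
    exact ⟨(s, i), by linarith [hsi.1], by linarith [hsi.2]⟩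
  refine (measureReal_mono hsub (measure_ne_top P _)).trans ((measureReal_biUnion_finset_le _ _).trans
    ((Finset.sum_le_sum fun si _ => hG.measureReal_cost_le hκ t si.2 _ hb).trans (le_of_eq ?_)))
  rw [Finset.sum_const, nsmul_eq_mul, Finset.card_univ, Fintype.card_prod, Fintype.card_fun,
    Fintype.card_bool, Fintype.card_fin]
  push_cast
  ring

lemma integral_maxHits_crossing_le [NeZero m] (hG : IsSmoothGameSequence P H κ G w φ)
    (hκ : 0 ≤ κ) (a : ℝ) {b : ℝ} (hb : 0 ≤ b) :
    ∫ ω, (maxHits (crossingCosts (m := m) w φ a b) fun t => (G t ω).repairCost : ℝ) ∂P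
      ≤ n * Real.log m + 2 * (n * 2 ^ n * (κ * b)) * T := by
  refine (integral_maxHits_le (fun t J => measurableSet_crossingCosts w φ a b t J)
    hG.measurable_cost hG.indep fun t J => hG.measureReal_crossing_le hκ t a hb J).trans
    (le_of_eq ?_)
  rw [Fintype.card_fun, Fintype.card_fin, Fintype.card_fin, Fintype.card_fin]
  push_cast
  rw [Real.log_pow]

lemma integrable_maxHits_crossing (hG : IsSmoothGameSequence P H κ G w φ) (a b : ℝ) :
    Integrable (fun ω =>
      (maxHits (crossingCosts (m := m) w φ a b) fun t => (G t ω).repairCost : ℝ)) P :=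
  integrable_maxHits (fun t J => measurableSet_crossingCosts w φ a b t J) hG.measurable_cost

lemma integrable_nonLipschitzCount (hG : IsSmoothGameSequence P H κ G w φ) (hH : 0 ≤ H) (ℓ : ℝ)
    {ε : ℝ} (hε : 0 ≤ ε) :
    Integrable (fun ω =>
      (nonLipschitzCount (subsidyCube n H) (fun t => (G t ω).loss) ℓ ε : ℝ)) P := by
  have hm := (measurable_nonLipschitzCount (isClosed_subsidyCube n H) (subsidyCube_nonempty n hH)
    (L := fun (t : Fin T) (C : Fin T → Fin n → ℝ) => (ofCost (w t) (φ t) (C t)).loss)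
    (fun t => (isPiecewiseContinuous_loss (w t) (φ t)).comp_continuous
      (h := fun z : (Fin T → Fin n → ℝ) × EuclideanSpace ℝ (Fin n) => (z.1 t, z.2))
      (by fun_prop)) ℓ hε).comp (measurable_pi_lambda _ hG.measurable_cost)
  have he : ∀ ω, (fun t => (G t ω).loss)
      = fun t => (ofCost (w t) (φ t) (G t ω).repairCost).loss := fun ω =>
    funext fun t => by rw [← hG.eq_ofCost]
  simp only [he]
  refine .of_bound (measurable_from_nat.comp hm).aestronglyMeasurable T (.of_forall fun ω => ?_)
  simp only [Real.norm_natCast]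
  exact_mod_cast nonLipschitzCount_le_card _ _ _ _

/-- The losses are `1 / 2`-dispersed. -/
theorem isDispersed (hG : IsSmoothGameSequence P H κ G w φ) (hH : 0 < H) (hκ : 0 < κ) {ℓ : ℝ}
    (hℓ : 0 ≤ ℓ) :
    IsDispersed P (subsidyCube n H) (fun t ω => (G t ω).loss) (1 / 2) ℓ
      (n * (Real.log (H + 2) + 1) + 4 * (n * 2 ^ n * κ)) 1 := by
  intro ε hε
  have hε0 : 0 ≤ ε := (Real.rpow_nonneg (Nat.cast_nonneg T) _).trans hε
  refine ⟨hG.integrable_nonLipschitzCount hH.le ℓ hε0, ?_⟩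
  rcases Nat.eq_zero_or_pos T with rfl | hT
  · have : ∀ ω, nonLipschitzCount (subsidyCube n H) (fun t => (G t ω).loss) ℓ ε = 0 := fun ω =>
      Nat.le_zero.1 (nonLipschitzCount_le_card _ _ _ _)
    simp [this]
  have hT1 : (1 : ℝ) ≤ T := by exact_mod_cast hT
  have hT0 : (0 : ℝ) < T := by linarith
  have hεpos : 0 < ε := (Real.rpow_pos_of_pos hT0 _).trans_le hε
  have hinv : 1 / ε ≤ T := by
    have h1 : (T : ℝ) ^ (-(1 : ℝ)) ≤ (T : ℝ) ^ (-(1 / 2 : ℝ)) :=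
      Real.rpow_le_rpow_of_exponent_le hT1 (by norm_num)
    rw [Real.rpow_neg_one] at h1
    rw [div_le_iff₀ hεpos]
    have h2 := mul_le_mul_of_nonneg_left (h1.trans hε) hT0.le
    rwa [mul_inv_cancel₀ hT0.ne'] at h2
  have hεT : 1 ≤ ε * T := by rwa [div_le_iff₀' hεpos] at hinv
  set m : ℕ := ⌈H / ε⌉₊ + 1 with hm
  have : NeZero m := ⟨by omega⟩
  have hmε : H ≤ m * ε := by
    rw [← div_le_iff₀ hεpos, hm]
    push_cast
    linarith [Nat.le_ceil (H / ε)]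
  have hle : ∀ ω, nonLipschitzCount (subsidyCube n H) (fun t => (G t ω).loss) ℓ ε
      ≤ maxHits (crossingCosts (m := m) w φ ε (2 * ε)) fun t => (G t ω).repairCost := by
    intro ω
    refine nonLipschitzCount_le fun ρ hρ ρ' hρ' hd => ?_
    have hcoord : ∀ i, |ρ i - ρ' i| ≤ ε := fun i => by
      have := (PiLp.norm_apply_le (ρ - ρ') i).trans (dist_eq_norm ρ ρ' ▸ hd)
      simpa using this
    have hJ : ∀ i, ∃ j : Fin m, (j : ℝ) * ε ≤ min (ρ i) (ρ' i) ∧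
        min (ρ i) (ρ' i) ≤ (j : ℝ) * ε + ε := fun i =>
      exists_lt_mul_le_le hεpos hmε (NeZero.pos m)
        ⟨le_min (hρ i).1 (hρ' i).1, (min_le_left _ _).trans (hρ i).2⟩
    choose J hJ1 hJ2 using hJ
    have hmem : (∀ i, ρ i ∈ gridCell ε (2 * ε) J i) ∧ ∀ i, ρ' i ∈ gridCell ε (2 * ε) J i := by
      refine ⟨fun i => ?_, fun i => ?_⟩ <;>
      · have h1 := hJ1 i
        have h2 := hJ2 i
        have h3 := abs_le.1 (hcoord i)
        rw [le_min_iff] at h1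
        constructor
        · tauto
        · rcases min_choice (ρ i) (ρ' i) with h | h <;> rw [h] at h2 <;> linarith [h3.1, h3.2]
    refine hG.natCard_loss_ne_le ε (2 * ε) J ω fun t ht => ⟨ρ, ρ', hmem.1, hmem.2, fun h => ?_⟩
    rw [h, sub_self, abs_zero] at ht
    exact absurd ht (not_lt.2 (mul_nonneg hℓ dist_nonneg))
  have hint := hG.integral_maxHits_crossing_le (m := m) hκ.le ε (b := 2 * ε) (by linarith)
  have hlogT : 0 ≤ Real.log T := Real.log_nonneg hT1
  have hlogm : Real.log m ≤ Real.log (H + 2) + Real.log T := by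
    rw [← Real.log_mul (by linarith) hT0.ne']
    refine Real.log_le_log (by exact_mod_cast NeZero.pos m) ?_
    have h1 := (Nat.ceil_lt_add_one (div_nonneg hH.le hεpos.le)).le
    have h2 : H / ε ≤ H * T := by
      rw [div_eq_mul_one_div]
      exact mul_le_mul_of_nonneg_left hinv hH.le
    rw [hm]
    push_cast
    linarith
  have hlogH : 0 ≤ Real.log (H + 2) := Real.log_nonneg (by linarith)
  refine (integral_mono (hG.integrable_nonLipschitzCount hH.le ℓ hε0)
    (hG.integrable_maxHits_crossing ε (2 * ε)) fun ω => Nat.cast_le.2 (hle ω)).trans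
    (hint.trans ?_)
  rw [pow_one]
  set q : ℝ := n * 2 ^ n * κ with hq
  have hq0 : 0 ≤ q := by positivity
  have hn0 : (0 : ℝ) ≤ n := Nat.cast_nonneg n
  calc n * Real.log m + 2 * (n * 2 ^ n * (κ * (2 * ε))) * T
      = n * Real.log m + 4 * q * (ε * T) := by rw [hq]; ring
    _ ≤ n * ((Real.log (H + 2) + 1) * (1 + Real.log T)) * (ε * T)
        + 4 * q * (ε * T) * (1 + Real.log T) := by
        refine add_le_add ?_ ?_
        · calc n * Real.log m ≤ n * ((Real.log (H + 2) + 1) * (1 + Real.log T)) :=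
                mul_le_mul_of_nonneg_left (by nlinarith [mul_nonneg hlogH hlogT]) hn0
            _ ≤ _ := le_mul_of_one_le_right (by positivity) hεT
        · exact le_mul_of_one_le_right (by positivity) (by linarith)
    _ = _ := by ring

end IsSmoothGameSequence

/-! ### Exponential weights on a grid of subsidies -/

section GridHedge

open ComponentGame

variable {n N T : ℕ} {H : ℝ}

/-- A point of the grid of width `H / N` in the cube of subsidy vectors. -/
noncomputable def gridPoint (hH : 0 ≤ H) (J : Fin n → Fin N) : subsidyCube n H :=
  ⟨WithLp.toLp 2 fun i => (J i : ℝ) * (H / N), fun i => by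
    have hJ : ((J i : ℕ) : ℝ) ≤ N := by exact_mod_cast (J i).2.le
    have hN : (N : ℝ) ≠ 0 := by
      have := (J i).pos
      positivity
    refine ⟨by positivity, ?_⟩
    change (J i : ℝ) * (H / N) ≤ H
    calc (J i : ℝ) * (H / N) ≤ N * (H / N) := mul_le_mul_of_nonneg_right hJ (by positivity)
      _ = H := mul_div_cancel₀ _ hN⟩

/-- The cumulative losses of the grid points. -/
noncomputable def gridLoss (hH : 0 ≤ H) {t : ℕ} (h : Fin t → ComponentGame n)
    (J : Fin n → Fin N) : ℝ :=
  ∑ s, (h s).loss (gridPoint hH J)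

lemma measurable_hedgeWeight_gridLoss (hH : 0 ≤ H) (η : ℝ) (t : ℕ) (J : Fin n → Fin N) :
    Measurable fun h : Fin t → ComponentGame n => hedgeWeight η (gridLoss hH h) J := by
  have hm : ∀ K : Fin n → Fin N, Measurable fun h : Fin t → ComponentGame n =>
      Real.exp (-η * gridLoss hH h K) := fun K =>
    Real.measurable_exp.comp ((Finset.measurable_sum _ fun s _ =>
      (measurable_loss _).comp (measurable_pi_apply s)).const_mul _)
  exact (hm J).div (Finset.measurable_sum _ fun K _ => hm K)

/-- The exponential weights algorithm with learning rate `η` on the grid of width `H / N`. -/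
noncomputable def gridHedge (n : ℕ) (hH : 0 ≤ H) (N : ℕ) [NeZero N] (η : ℝ) :
    OnlineAlgorithm n H where
  policy t :=
    { toFun := fun h => ∑ J : Fin n → Fin N,
        ENNReal.ofReal (hedgeWeight η (gridLoss hH h) J) • Measure.dirac (gridPoint hH J)
      measurable' := by
        refine Measure.measurable_of_measurable_coe _ fun s _ => ?_
        simp only [Measure.finsetSum_apply, Measure.smul_apply, smul_eq_mul]
        exact Finset.measurable_sum _ fun J _ =>
          (measurable_hedgeWeight_gridLoss hH η t J).ennreal_ofReal.mul_const _ }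
  markov t := ⟨fun h => ⟨by
    change (∑ J : Fin n → Fin N, ENNReal.ofReal (hedgeWeight η (gridLoss hH h) J) •
      Measure.dirac (gridPoint hH J)) Set.univ = 1
    simp only [Measure.finsetSum_apply, Measure.smul_apply, smul_eq_mul, measure_univ, mul_one]
    rw [← ENNReal.ofReal_sum_of_nonneg fun J _ => hedgeWeight_nonneg _ _ _, sum_hedgeWeight,
      ENNReal.ofReal_one]⟩⟩
  uses_losses t h h' hh := by
    have : gridLoss (N := N) hH h = gridLoss hH h' := funext fun J =>
      Finset.sum_congr rfl fun s _ => hh s _ (gridPoint hH J).2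
    change ∑ J : Fin n → Fin N, _ = ∑ J : Fin n → Fin N, _
    rw [this]

lemma integral_gridHedge [NeZero N] (hH : 0 ≤ H) (η : ℝ) {t : ℕ} (h : Fin t → ComponentGame n)
    (f : subsidyCube n H → ℝ) :
    ∫ σ, f σ ∂((gridHedge n hH N η).policy t h)
      = ∑ J : Fin n → Fin N, hedgeWeight η (gridLoss hH h) J * f (gridPoint hH J) := by
  change ∫ σ, f σ ∂(∑ J : Fin n → Fin N, ENNReal.ofReal (hedgeWeight η (gridLoss hH h) J) •
      Measure.dirac (gridPoint hH J)) = _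
  rw [integral_finsetSum_measure fun J _ =>
    (integrable_dirac (by simp)).smul_measure ENNReal.ofReal_ne_top]
  refine Finset.sum_congr rfl fun J _ => ?_
  rw [integral_smul_measure, integral_dirac, ENNReal.toReal_ofReal (hedgeWeight_nonneg _ _ _),
    smul_eq_mul]

lemma regret_gridHedge [NeZero N] (hH : 0 ≤ H) (η : ℝ) (g : Fin T → ComponentGame n) :
    (gridHedge n hH N η).regret g
      = ∑ t : Fin T, ∑ J : Fin n → Fin N,
          hedgeWeight η (gridLoss hH fun s : Fin (t : ℕ) => g (Fin.castLE t.isLt.le s)) J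
            * (g t).loss (gridPoint hH J)
        - ⨅ σ : subsidyCube n H, ∑ t : Fin T, (g t).loss σ := by
  rw [OnlineAlgorithm.regret]
  congr 1
  refine Finset.sum_congr rfl fun t _ => ?_
  rw [integral_gridHedge hH η _ fun σ : subsidyCube n H => (g t).loss σ]

lemma regret_gridHedge_le [NeZero N] (hH : 0 ≤ H) {η B M : ℝ} (hη : 0 < η)
    {g : Fin T → ComponentGame n} (h0 : ∀ t, ∀ σ ∈ subsidyCube n H, 0 ≤ (g t).loss σ)
    (hB : ∀ t, ∀ σ ∈ subsidyCube n H, (g t).loss σ ≤ B)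
    (hM : ∀ σ ∈ subsidyCube n H, ∃ J : Fin n → Fin N,
      ∑ t, (g t).loss (gridPoint hH J) ≤ ∑ t, (g t).loss σ + M) :
    (gridHedge n hH N η).regret g ≤ n * Real.log N / η + η * T * B ^ 2 + M := by
  have : Nonempty (subsidyCube n H) := (subsidyCube_nonempty n hH).to_subtype
  let l : ℕ → (Fin n → Fin N) → ℝ := fun s J =>
    if h : s < T then (g ⟨s, h⟩).loss (gridPoint hH J) else 0
  have hl : ∀ (t : Fin T) J, l t J = (g t).loss (gridPoint hH J) := fun t J => by simp [l]
  have hc : ∀ t : Fin T, (gridLoss (N := N) hH fun s : Fin (t : ℕ) => g (Fin.castLE t.isLt.le s))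
      = fun J => ∑ s ∈ Finset.range t, l s J := fun t => funext fun J => by
    rw [gridLoss, ← Fin.sum_univ_eq_sum_range (fun s => l s J)]
    exact Finset.sum_congr rfl fun s _ => (hl (Fin.castLE t.isLt.le s) J).symm
  rw [regret_gridHedge, sub_le_comm]
  refine le_ciInf fun σ => ?_
  obtain ⟨J, hJ⟩ := hM σ σ.2
  have h := hedge_regret_le hη l T
    (fun t ht K => (hl ⟨t, ht⟩ K).ge.trans' (h0 _ _ (gridPoint hH K).2))
    (fun t ht K => (hl ⟨t, ht⟩ K).le.trans (hB _ _ (gridPoint hH K).2)) J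
  rw [← Fin.sum_univ_eq_sum_range (fun t => ∑ j, hedgeWeight η
      (fun k => ∑ s ∈ Finset.range t, l s k) j * l t j),
    ← Fin.sum_univ_eq_sum_range (fun t => l t J), Fintype.card_fun, Fintype.card_fin,
    Fintype.card_fin, Nat.cast_pow, Real.log_pow] at h
  simp only [hl, ← hc] at h
  linarith

lemma abs_regret_gridHedge_le [NeZero N] (hH : 0 ≤ H) {η B : ℝ}
    {g : Fin T → ComponentGame n} (h0 : ∀ t, ∀ σ ∈ subsidyCube n H, 0 ≤ (g t).loss σ)
    (hB : ∀ t, ∀ σ ∈ subsidyCube n H, (g t).loss σ ≤ B) :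
    |(gridHedge n hH N η).regret g| ≤ T * B := by
  have : Nonempty (subsidyCube n H) := (subsidyCube_nonempty n hH).to_subtype
  have h1 : ∀ f : Fin T → ℝ, (∀ t, f t ≤ B) → ∑ t, f t ≤ T * B := fun f hf =>
    (Finset.sum_le_sum fun t _ => hf t).trans (by simp)
  have hw : ∀ (t : Fin T) (c : (Fin n → Fin N) → ℝ),
      0 ≤ ∑ J, hedgeWeight η c J * (g t).loss (gridPoint hH J) ∧
      ∑ J, hedgeWeight η c J * (g t).loss (gridPoint hH J) ≤ B := fun t c => by
    refine ⟨Finset.sum_nonneg fun J _ =>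
      mul_nonneg (hedgeWeight_nonneg _ _ _) (h0 t _ (gridPoint hH J).2), ?_⟩
    calc _ ≤ ∑ J, hedgeWeight η c J * B := Finset.sum_le_sum fun J _ =>
          mul_le_mul_of_nonneg_left (hB t _ (gridPoint hH J).2) (hedgeWeight_nonneg _ _ _)
      _ = B := by rw [← Finset.sum_mul, sum_hedgeWeight, one_mul]
  have hσ : ∀ σ : subsidyCube n H, 0 ≤ ∑ t : Fin T, (g t).loss σ := fun σ =>
    Finset.sum_nonneg fun t _ => h0 t σ σ.2
  have hinf0 : 0 ≤ ⨅ σ : subsidyCube n H, ∑ t : Fin T, (g t).loss σ := le_ciInf hσ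
  have hinf : ⨅ σ : subsidyCube n H, ∑ t : Fin T, (g t).loss σ ≤ T * B :=
    (ciInf_le ⟨0, by rintro _ ⟨σ, rfl⟩; exact hσ σ⟩ (Classical.arbitrary _)).trans
      (h1 _ fun t => hB t _ (Classical.arbitrary (subsidyCube n H)).2)
  rw [regret_gridHedge, abs_le]
  constructor
  · linarith [Finset.sum_nonneg fun (t : Fin T) (_ : t ∈ Finset.univ) => (hw t
      (gridLoss hH fun s : Fin (t : ℕ) => g (Fin.castLE t.isLt.le s))).1]
  · linarith [h1 _ fun t => (hw t
      (gridLoss hH fun s : Fin (t : ℕ) => g (Fin.castLE t.isLt.le s))).2]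

lemma loss_of_isEmpty (G : ComponentGame 0) (σ : EuclideanSpace ℝ (Fin 0)) : G.loss σ = 0 := by
  simp [ComponentGame.loss]

end GridHedge

namespace IsSmoothGameSequence

open ComponentGame

variable {n N T : ℕ} {Ω : Type*} [MeasurableSpace Ω] {P : Measure Ω}
  {H κ : ℝ} {G : Fin T → Ω → ComponentGame n} {w : Fin T → Fin n → unitInterval}
  {φ : Fin T → (Fin n → Bool) → Bool}

lemma measurable_game (hG : IsSmoothGameSequence P H κ G w φ) (t : Fin T) :
    Measurable (G t) := by
  refine measurable_comap_iff.2 ?_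
  have : toTuple ∘ G t = fun ω => ((G t ω).repairCost, w t, φ t) := funext fun ω => by
    simp only [Function.comp_apply, toTuple, hG.workProb_eq, hG.system_eq]
  rw [this]
  exact (hG.measurable_cost t).prodMk measurable_const

lemma measurable_regret_gridHedge [NeZero N] (hG : IsSmoothGameSequence P H κ G w φ)
    (hH : 0 ≤ H) (η : ℝ) : Measurable fun ω => (gridHedge n hH N η).regret fun t => G t ω := by
  simp only [regret_gridHedge]
  refine .sub ?_ ?_
  · refine Finset.measurable_sum _ fun t _ => Finset.measurable_sum _ fun J _ => .mul ?_ ?_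
    · exact (measurable_hedgeWeight_gridLoss hH η t J).comp
        (measurable_pi_lambda _ fun s => hG.measurable_game (Fin.castLE t.isLt.le s))
    · exact (measurable_loss _).comp (hG.measurable_game t)
  · have hm := (measurable_iInf_sum (isClosed_subsidyCube n H) (subsidyCube_nonempty n hH)
      (L := fun (t : Fin T) (C : Fin T → Fin n → ℝ) => (ofCost (w t) (φ t) (C t)).loss)
      (fun t => (isPiecewiseContinuous_loss (w t) (φ t)).comp_continuous
        (h := fun z : (Fin T → Fin n → ℝ) × EuclideanSpace ℝ (Fin n) => (z.1 t, z.2))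
        (by fun_prop)) fun t C => exists_forall_le_loss _).comp
      (measurable_pi_lambda _ hG.measurable_cost)
    have he : ∀ ω (σ : EuclideanSpace ℝ (Fin n)), ∑ t, (G t ω).loss σ
        = ∑ t, (ofCost (w t) (φ t) (G t ω).repairCost).loss σ := fun ω σ =>
      Finset.sum_congr rfl fun t _ => by rw [← hG.eq_ofCost]
    simp only [he]
    exact hm

lemma ae_loss_mem_Icc (hG : IsSmoothGameSequence P H κ G w φ) (hH : 0 ≤ H) :
    ∀ᵐ ω ∂P, ∀ t, ∀ σ ∈ subsidyCube n H, (G t ω).loss σ ∈ Set.Icc 0 ((2 * H + 1) * n) := by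
  filter_upwards [hG.cost_le, hG.loss_nonneg] with ω h1 h2 t σ hσ
  exact ⟨h2 t σ hσ, loss_le _ hH (h1 t) σ⟩

lemma exists_gridPoint_loss_le [NeZero N] (hG : IsSmoothGameSequence P H κ G w φ) (hH : 0 < H)
    {B : ℝ} {ω : Ω} (hB : ∀ t, ∀ σ ∈ subsidyCube n H, (G t ω).loss σ ∈ Set.Icc 0 B)
    {σ : EuclideanSpace ℝ (Fin n)} (hσ : σ ∈ subsidyCube n H) :
    ∃ J : Fin n → Fin N, ∑ t, (G t ω).loss (gridPoint hH.le J) ≤ ∑ t, (G t ω).loss σ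
      + (maxHits (crossingCosts (m := N) w φ (H / N) (H / N)) fun t => (G t ω).repairCost) * B := by
  have hN : (0 : ℝ) < N := by exact_mod_cast NeZero.pos N
  have hδ : 0 < H / N := div_pos hH hN
  have hJ : ∀ i, ∃ j : Fin N, (j : ℝ) * (H / N) ≤ σ i ∧ σ i ≤ (j : ℝ) * (H / N) + H / N :=
    fun i => exists_lt_mul_le_le hδ (mul_div_cancel₀ _ hN.ne').ge (NeZero.pos N) (hσ i)
  choose J hJ using hJ
  refine ⟨J, ?_⟩
  have hle := hG.natCard_loss_ne_le (H / N) (H / N) J ω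
    (p := fun t => (G t ω).loss (gridPoint hH.le J) ≠ (G t ω).loss σ) fun t ht =>
      ⟨gridPoint hH.le J, σ, fun i => ⟨le_rfl, le_add_of_nonneg_right hδ.le⟩, fun i => hJ i, ht⟩
  rcases isEmpty_or_nonempty (Fin T) with hT | ⟨⟨t₀⟩⟩
  · rw [Nat.le_zero.1 ((maxHits_le_card (crossingCosts (m := N) w φ (H / N) (H / N))
      fun t => (G t ω).repairCost).trans_eq Fintype.card_eq_zero)]
    simp
  have hB0 : 0 ≤ B := (hB t₀ σ hσ).1.trans (hB t₀ σ hσ).2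
  have hle' := mul_le_mul_of_nonneg_right (Nat.cast_le (α := ℝ).2 hle) hB0
  refine le_trans ?_ (add_le_add_right hle' _)
  have hcard := natCard_eq_sum_indicator
    (fun _ : Fin T => {t | (G t ω).loss (gridPoint hH.le J) ≠ (G t ω).loss σ}) id
  simp only [id, Set.mem_ofPred_eq] at hcard
  rw [hcard, Finset.sum_mul, ← Finset.sum_add_distrib]
  refine Finset.sum_le_sum fun t _ => ?_
  by_cases h : (G t ω).loss (gridPoint hH.le J) = (G t ω).loss σ
  · simp [h]
  · rw [Set.indicator_of_mem (by exact h), one_mul]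
    linarith [(hB t _ (gridPoint hH.le J).2).2, (hB t σ hσ).1]

variable [IsProbabilityMeasure P]

lemma integrable_regret_gridHedge [NeZero N] (hG : IsSmoothGameSequence P H κ G w φ)
    (hH : 0 ≤ H) (η : ℝ) :
    Integrable (fun ω => (gridHedge n hH N η).regret fun t => G t ω) P := by
  refine .of_bound (hG.measurable_regret_gridHedge hH η).aestronglyMeasurable
    (T * ((2 * H + 1) * n)) ?_
  filter_upwards [hG.ae_loss_mem_Icc hH] with ω hω
  exact abs_regret_gridHedge_le hH (fun t σ hσ => (hω t σ hσ).1) fun t σ hσ => (hω t σ hσ).2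

lemma integral_regret_gridHedge_le [NeZero N] (hG : IsSmoothGameSequence P H κ G w φ)
    (hH : 0 < H) (hκ : 0 ≤ κ) {η : ℝ} (hη : 0 < η) :
    ∫ ω, (gridHedge n hH.le N η).regret (fun t => G t ω) ∂P
      ≤ n * Real.log N / η + η * T * ((2 * H + 1) * n) ^ 2
        + min (T : ℝ) (n * Real.log N + 2 * (κ * H * n * 2 ^ n * T / N)) * ((2 * H + 1) * n) := by
  set B : ℝ := (2 * H + 1) * n with hBdef
  have hB0 : 0 ≤ B := by positivity
  have hint := hG.integrable_maxHits_crossing (m := N) (H / N) (H / N)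
  set Z : Ω → ℝ := fun ω =>
    (maxHits (crossingCosts (m := N) w φ (H / N) (H / N)) fun t => (G t ω).repairCost : ℝ) with hZ
  have h1 : ∫ ω, Z ω ∂P ≤ n * Real.log N + 2 * (κ * H * n * 2 ^ n * T / N) :=
    (hG.integral_maxHits_crossing_le (m := N) hκ (H / N) (b := H / N) (by positivity)).trans
      (le_of_eq (by ring))
  have h2 : ∫ ω, Z ω ∂P ≤ T := by
    have : ∫ ω, Z ω ∂P ≤ ∫ _, (T : ℝ) ∂P := integral_mono hint (integrable_const _) fun ω => by
      have := maxHits_le_card (crossingCosts (m := N) w φ (H / N) (H / N))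
        fun t => (G t ω).repairCost
      rw [Fintype.card_fin] at this
      exact Nat.cast_le.2 this
    simpa using this
  have h3 : ∫ ω, (gridHedge n hH.le N η).regret (fun t => G t ω) ∂P
      ≤ ∫ ω, (n * Real.log N / η + η * T * B ^ 2) + Z ω * B ∂P := by
    refine integral_mono_ae (hG.integrable_regret_gridHedge hH.le η)
      ((integrable_const _).add (hint.mul_const B)) ?_
    filter_upwards [hG.ae_loss_mem_Icc hH.le] with ω hω
    exact regret_gridHedge_le hH.le hη (fun t σ hσ => (hω t σ hσ).1)
      (fun t σ hσ => (hω t σ hσ).2) fun σ hσ => hG.exists_gridPoint_loss_le hH hω hσ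
  rw [integral_add (integrable_const _) (hint.mul_const B), integral_mul_const] at h3
  simp only [integral_const, probReal_univ, one_smul] at h3
  exact h3.trans (add_le_add_right (mul_le_mul_of_nonneg_right (le_min h2 h1) hB0) _)

end IsSmoothGameSequence

/-- The expected regret of exponential weights on a suitable grid with a suitable learning rate. -/
theorem exists_onlineAlgorithm_regret_le (n : ℕ) {H κ : ℝ} (hH : 0 < H) (hκ : 0 < κ) (T : ℕ) :
    ∃ alg : OnlineAlgorithm n H, ∀ (Ω : Type*) [MeasurableSpace Ω] (P : Measure Ω)
      [IsProbabilityMeasure P] (G : Fin T → Ω → ComponentGame n)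
      (workProb : Fin T → Fin n → unitInterval) (system : Fin T → (Fin n → Bool) → Bool),
      IsSmoothGameSequence P H κ G workProb system →
      Integrable (fun ω => alg.regret fun t => G t ω) P ∧
      ∫ ω, alg.regret (fun t => G t ω) ∂P
        ≤ 7 * ((2 * H + 1) * n) * Real.sqrt (n * T * Real.log (2 + T + κ * H * n * 2 ^ n)) := by
  set X : ℝ := κ * H * n * 2 ^ n with hX
  have hX0 : 0 ≤ X := by positivity
  set Λ := Real.log (2 + T + X) with hΛ
  set R := Real.sqrt (n * T * Λ) with hR
  set B := (2 * H + 1) * n with hB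
  set N : ℕ := ⌈X * T⌉₊ + 1 with hN
  have : NeZero N := ⟨by omega⟩
  refine ⟨gridHedge n hH.le N (R / (T * B)), fun Ω _ P _ G w φ hG =>
    ⟨hG.integrable_regret_gridHedge hH.le _, ?_⟩⟩
  rcases Nat.eq_zero_or_pos T with rfl | hT
  · simp only [OnlineAlgorithm.regret]
    simp only [Finset.univ_eq_empty, Finset.sum_empty, Real.iInf_const_zero, sub_zero,
      integral_zero]
    positivity
  rcases Nat.eq_zero_or_pos n with rfl | hn
  · simp only [OnlineAlgorithm.regret, loss_of_isEmpty]
    simp only [integral_zero, Finset.sum_const_zero, Real.iInf_const_zero, sub_zero]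
    positivity
  have hT1 : (1 : ℝ) ≤ T := by exact_mod_cast hT
  have hn1 : (1 : ℝ) ≤ n := by exact_mod_cast hn
  have hBpos : 0 < B := by positivity
  have hΛ1 : 1 ≤ Λ := by
    rw [hΛ, Real.le_log_iff_exp_le (by linarith)]
    linarith [Real.exp_one_lt_three]
  have hRsq : R ^ 2 = n * T * Λ := Real.sq_sqrt (by positivity)
  have hR1 : 1 ≤ R := Real.one_le_sqrt.2 (one_le_mul_of_one_le_of_one_le
    (one_le_mul_of_one_le_of_one_le hn1 hT1) hΛ1)
  have hNpos : (0 : ℝ) < N := by exact_mod_cast NeZero.pos N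
  have hXN : X * T ≤ N := by
    rw [hN]
    push_cast
    linarith [Nat.le_ceil (X * T)]
  have hlogN : Real.log N ≤ 2 * Λ := by
    have : (N : ℝ) ≤ (2 + T + X) ^ 2 := by
      rw [hN]
      push_cast
      have := (Nat.ceil_lt_add_one (mul_nonneg hX0 (Nat.cast_nonneg T))).le
      nlinarith [mul_nonneg hX0 (Nat.cast_nonneg (α := ℝ) T)]
    calc Real.log N ≤ Real.log ((2 + T + X) ^ 2) := Real.log_le_log hNpos this
      _ = 2 * Λ := by rw [Real.log_pow, hΛ]; push_cast; ring
  have hnlog : n * Real.log N ≤ 2 * (n * Λ) := by nlinarith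
  have hηpos : 0 < R / (T * B) := by positivity
  have hmin : min (T : ℝ) (n * Real.log N + 2 * (X * T / N)) ≤ 4 * R := by
    have h1 : X * T / N ≤ 1 := (div_le_one hNpos).2 hXN
    rcases le_total (n * Λ) T with h | h
    · have h2 : n * Λ ≤ R := Real.le_sqrt_of_sq_le (by
        nlinarith [mul_pos (by linarith : (0 : ℝ) < n) (by linarith : 0 < Λ)])
      exact (min_le_right _ _).trans (by linarith)
    · have h2 : (T : ℝ) ≤ R := Real.le_sqrt_of_sq_le (by nlinarith)
      exact (min_le_left _ _).trans (by linarith)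
  have h1 : n * Real.log N / (R / (T * B)) ≤ 2 * (R * B) := by
    rw [div_div_eq_mul_div, div_le_iff₀ (by linarith)]
    calc n * Real.log N * (T * B) ≤ 2 * (n * Λ) * (T * B) :=
          mul_le_mul_of_nonneg_right hnlog (by positivity)
      _ = 2 * R ^ 2 * B := by rw [hRsq]; ring
      _ = _ := by ring
  have h2 : R / (T * B) * T * B ^ 2 = R * B := by field_simp
  refine (hG.integral_regret_gridHedge_le hH hκ.le hηpos).trans ?_
  rw [← hB, ← hX, h2]
  nlinarith [mul_le_mul_of_nonneg_right hmin hBpos.le]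

theorem mainTheorem10 :
    ∃ A : ℝ, ∀ (n : ℕ) (H κ : ℝ), 0 < H → 0 < κ →
      (∃ (K : ℝ) (p : ℕ), ∀ (T : ℕ) (Ω : Type*) [MeasurableSpace Ω] (P : Measure Ω)
          [IsProbabilityMeasure P] (G : Fin T → Ω → ComponentGame n)
          (workProb : Fin T → Fin n → unitInterval) (system : Fin T → (Fin n → Bool) → Bool),
          IsSmoothGameSequence P H κ G workProb system →
          ∀ ℓ : ℝ, 0 ≤ ℓ →
            IsDispersed P (subsidyCube n H) (fun t ω => (G t ω).loss) (1 / 2) ℓ K p) ∧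
      (∀ T : ℕ, ∃ alg : OnlineAlgorithm n H,
        ∀ (Ω : Type*) [MeasurableSpace Ω] (P : Measure Ω)
          [IsProbabilityMeasure P] (G : Fin T → Ω → ComponentGame n)
          (workProb : Fin T → Fin n → unitInterval) (system : Fin T → (Fin n → Bool) → Bool),
          IsSmoothGameSequence P H κ G workProb system →
          Integrable (fun ω => alg.regret fun t => G t ω) P ∧
          ∫ ω, alg.regret (fun t => G t ω) ∂P
            ≤ A * ((2 * H + 1) * n)
                * Real.sqrt (n * T * Real.log (2 + T + κ * H * n * 2 ^ n)) ∧
          (2 + κ * H * n * 2 ^ n ≤ T →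
            ∫ ω, alg.regret (fun t => G t ω) ∂P
              ≤ A * ((2 * H + 1) * n) * Real.sqrt (n * T * Real.log T))) := by
  refine ⟨10, fun n H κ hH hκ => ⟨⟨_, 1, fun T Ω _ P _ G w φ hG ℓ hℓ =>
    hG.isDispersed hH hκ hℓ⟩, fun T => ?_⟩⟩
  obtain ⟨alg, halg⟩ := exists_onlineAlgorithm_regret_le n hH hκ T
  refine ⟨alg, fun Ω _ P _ G w φ hG => ?_⟩
  obtain ⟨hint, hle⟩ := halg Ω P G w φ hG
  have hB : 0 ≤ (2 * H + 1) * n := by positivity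
  have hX : 0 ≤ κ * H * n * 2 ^ n := by positivity
  refine ⟨hint, hle.trans ?_, fun hT => hle.trans ?_⟩
  · gcongr
    norm_num
  · have hT2 : (2 : ℝ) ≤ T := by linarith
    have hlog : Real.log (2 + T + κ * H * n * 2 ^ n) ≤ 2 * Real.log T := by
      calc Real.log (2 + T + κ * H * n * 2 ^ n) ≤ Real.log ((T : ℝ) ^ 2) :=
            Real.log_le_log (by linarith) (by nlinarith)
        _ = 2 * Real.log T := by rw [Real.log_pow]; push_cast; ring
    have hsqrt : Real.sqrt (n * T * Real.log (2 + T + κ * H * n * 2 ^ n))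
        ≤ Real.sqrt 2 * Real.sqrt (n * T * Real.log T) := by
      rw [← Real.sqrt_mul (by norm_num)]
      refine Real.sqrt_le_sqrt ?_
      calc n * T * Real.log (2 + T + κ * H * n * 2 ^ n) ≤ n * T * (2 * Real.log T) :=
            mul_le_mul_of_nonneg_left hlog (by positivity)
        _ = _ := by ring
    have h2 : Real.sqrt 2 ≤ 10 / 7 := Real.sqrt_le_iff.2 ⟨by norm_num, by norm_num⟩
    calc 7 * ((2 * H + 1) * n) * Real.sqrt (n * T * Real.log (2 + T + κ * H * n * 2 ^ n))
        ≤ 7 * ((2 * H + 1) * n) * (10 / 7 * Real.sqrt (n * T * Real.log T)) :=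
          mul_le_mul_of_nonneg_left
            (hsqrt.trans (mul_le_mul_of_nonneg_right h2 (Real.sqrt_nonneg _))) (by positivity)
      _ = _ := by ring
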